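/- Let $\tau$ be a countable vocabulary and let $\mathcal A$ be a countable $\tau$-structure. \emph{Formulas and Scott rank.} The $\Sigma_0$ and the $\Pi_0$ formulas are the finitary quantifier-free formulas. For an ordinal $\alpha>0$, a $\Sigma_\alpha$ formula is a countable disjunction $\bigvee_i\exists\bar y_i\,\varphi_i(\bar x,\bar y_i)$ with each $\varphi_i$ a $\Pi_{\beta_i}$ formula for some $\beta_i<\alpha$, and a $\Pi_\alpha$ formula is a countable conjunction $\bigwedge_i\forall\bar y_i\,\varphi_i(\bar x,\bar y_i)$ with each $\varphi_i$ a $\Sigma_{\beta_i}$ formula for some $\beta_i<\alpha$. The (parameterless) Scott rank $SR(\mathcal M)$ of a structure $\mathcal M$ is the least ordinal $\alpha$ such that the automorphism orbit of every finite tuple from $\mathcal M$ is definable in $\mathcal M$ by a $\Sigma_\alpha$ formula without parameters. \emph{Tree of tuples.} For each $n$ fix a finite set $F_n$ of atomic $\tau$-formulas (equations included) in the variables $x_0,\dots,x_{n-1}$, such that $F_0\subseteq F_1\subseteq\cdots$ and every atomic formula (in the variables $x_0,x_1,\dots$) belongs to some $F_n$. The finite atomic diagram of $\bar a\in A^n$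 is $D(\bar a)=\{\varphi\in F_n:\mathcal A\models\varphi(\bar a)\}$; fix an injective coding of the pairs $(n,S)$, $S$ a finite set of formulas in $x_0,\dots,x_{n-1}$, by natural numbers. The (replicated) tree of tuples $\mathcal T_{\mathcal A}$ is the following labeled tree. Its nodes are the finite sequences $\sigma=((a_0,k_0),\dots,(a_{n-1},k_{n-1}))$ of elements of $A\times\mathbb N$, ordered by extension; the node $\sigma$ is a copy of the tuple $\bar a=(a_0,\dots,a_{n-1})$, and its label is the natural number that codes $(n,D(\bar a))$. Its vocabulary consists of the tree order, the parent function (the root being its own parent), and one unary predicate for each label $c\in\mathbb N$. \textbf{Theorem.} For all choices of the sets $F_n$ and of the coding, the Scott ranks of $\mathcal A$ and of $\mathcal T_{\mathcal A}$ exist, and $SR(\mathcal T_{\mathcal A})=SR(\mathcal A)$ whenever $SR(\mathcal A)\ge 1$. If $SR(\mathcal A)=0$, then $SR(\mathcal T_{\mathcal A})\le 1$; and if $F_n$ consists of all atomic formulas in $x_0,\dots,x_{n-1}$ for every $n$ (which is possible for a finite relational vocabulary, for example), then $SR(\mathcal T_{\mathcal A})=SR(\mathcal A)$ also when $SR(\mathcal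 A)=0$. In particular, $\max(1,SR(\mathcal T_{\mathcal A}))=\max(1,SR(\mathcal A))$ always, that is, the two ranks are equal if the Scott rank is taken to be the least such $\alpha\geq 1$. -/

import Mathlib

open FirstOrder FirstOrder.Language

universe u v w

/-! ## Infinitary formulas and the classes `Σ_α`, `Π_α` -/

/-- Formulas of the infinitary logic `L_{ω₁ω}` with free variables `x_0, …, x_{n-1}`, in the usual
normal form: finitary quantifier-free formulas, countable disjunctions
`⋁_i ∃ y_1 … y_{k i} φ_i(x, y)`, and countable conjunctions `⋀_i ∀ y_1 … y_{k i} φ_i(x, y)`.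
(Finite or empty disjunctions and conjunctions are obtained by repeating disjuncts, or by using a
contradiction or a tautology.) -/
inductive InfFormula (L : FirstOrder.Language.{u, v}) : ℕ → Type (max u v)
  | qf {n : ℕ} (φ : L.Formula (Fin n)) (h : φ.IsQF) : InfFormula L n
  | disjEx {n : ℕ} (k : ℕ → ℕ) (φ : ∀ i, InfFormula L (n + k i)) : InfFormula L n
  | conjAll {n : ℕ} (k : ℕ → ℕ) (φ : ∀ i, InfFormula L (n + k i)) : InfFormula L n

/-- Satisfaction of an infinitary formula by a tuple. -/
def InfFormula.Realize {L : FirstOrder.Language.{u, v}} {M : Type w} [L.Structure M] :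
    ∀ {n : ℕ}, InfFormula L n → (Fin n → M) → Prop
  | _, .qf φ _, x => Formula.Realize φ x
  | _, .disjEx k φ, x => ∃ i, ∃ y : Fin (k i) → M, (φ i).Realize (Fin.append x y)
  | _, .conjAll k φ, x => ∀ i, ∀ y : Fin (k i) → M, (φ i).Realize (Fin.append x y)

/-- The two sides of the hierarchy of infinitary formulas. -/
inductive FormulaSide
  | sigma
  | pi

/-- The hierarchy of infinitary formulas. At level `0` both sides consist of the finitary
quantifier-free formulas. For `α > 0`, a formula is `Σ_α` if it is a countable disjunction of
formulas `∃ y φ_i`, where `φ_i` is `Π_β` for some `β < α`, and it is `Π_α` if it is a countable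
conjunction of formulas `∀ y φ_i`, where `φ_i` is `Σ_β` for some `β < α`. -/
inductive InfFormula.InClass {L : FirstOrder.Language.{u, v}} :
    FormulaSide → Ordinal.{0} → ∀ {n : ℕ}, InfFormula L n → Prop
  | qf (s : FormulaSide) {n : ℕ} (φ : L.Formula (Fin n)) (h : φ.IsQF) :
      InClass s 0 (InfFormula.qf φ h)
  | disjEx {α : Ordinal.{0}} {n : ℕ} (k : ℕ → ℕ) (φ : ∀ i, InfFormula L (n + k i))
      (β : ℕ → Ordinal.{0}) (hβ : ∀ i, β i < α) (hφ : ∀ i, InClass .pi (β i) (φ i)) :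
      InClass .sigma α (InfFormula.disjEx k φ)
  | conjAll {α : Ordinal.{0}} {n : ℕ} (k : ℕ → ℕ) (φ : ∀ i, InfFormula L (n + k i))
      (β : ℕ → Ordinal.{0}) (hβ : ∀ i, β i < α) (hφ : ∀ i, InClass .sigma (β i) (φ i)) :
      InClass .pi α (InfFormula.conjAll k φ)

/-- `φ` is a `Σ_α` formula. -/
def InfFormula.IsSigma {L : FirstOrder.Language.{u, v}} {n : ℕ} (α : Ordinal.{0}) (φ : InfFormula L n) :
    Prop :=
  φ.InClass .sigma α

/-! ## The (parameterless) Scott rank -/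

/-- The automorphism orbit of a tuple `a` of elements of `M`. -/
def autOrbit (L : FirstOrder.Language.{u, v}) {M : Type w} [L.Structure M] {n : ℕ} (a : Fin n → M) :
    Set (Fin n → M) :=
  {b | ∃ f : M ≃[L] M, ∀ i, f (a i) = b i}

/-- The automorphism orbits of all tuples of `M` are `Σ_α`-definable without parameters. -/
def OrbitsSigmaDefinable (L : FirstOrder.Language.{u, v}) (M : Type w) [L.Structure M] (α : Ordinal.{0}) :
    Prop :=
  ∀ (n : ℕ) (a : Fin n → M),
    ∃ φ : InfFormula L n, φ.IsSigma α ∧ ∀ b : Fin n → M, φ.Realize b ↔ b ∈ autOrbit L a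

/-- `α` is the (parameterless) Scott rank of `M`: the least ordinal such that the automorphism
orbits of all tuples of `M` are `Σ_α`-definable. -/
def IsScottRank (L : FirstOrder.Language.{u, v}) (M : Type w) [L.Structure M] (α : Ordinal.{0}) : Prop :=
  IsLeast {γ : Ordinal.{0} | OrbitsSigmaDefinable L M γ} α

/-! ## Finite atomic diagrams and their codes -/

/-- A convention for finite atomic diagrams in the vocabulary `L` and for coding them by natural
numbers. The diagram of an `n`-tuple records which members of a finite set `level n` of atomic
formulas in `x_0, …, x_{n-1}` the tuple satisfies; the sets `level n` increase, and every atomic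
formula belongs to one of them when it is regarded as a formula in sufficiently many variables.
The number `code ⟨n, S⟩` is a code for the length `n` together with the diagram `S`. -/
structure AtomicDiagramCoding (L : FirstOrder.Language.{u, v}) where
  level : ∀ n : ℕ, Finset (L.Formula (Fin n))
  isAtomic : ∀ (n : ℕ), ∀ φ ∈ level n, BoundedFormula.IsAtomic φ
  mono : ∀ (m n : ℕ) (h : m ≤ n), ∀ φ ∈ level m, Formula.relabel (Fin.castLE h) φ ∈ level n
  exhaustive : ∀ (m : ℕ) (φ : L.Formula (Fin m)), BoundedFormula.IsAtomic φ →
    ∃ (n : ℕ) (h : m ≤ n), Formula.relabel (Fin.castLE h) φ ∈ level n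
  code : (Σ n : ℕ, Finset (L.Formula (Fin n))) → ℕ
  code_injective : Function.Injective code

/-- The finite atomic diagrams are the full ones: the diagram of an `n`-tuple records all atomic
formulas in `n` variables. -/
def AtomicDiagramCoding.IsFull {L : FirstOrder.Language.{u, v}} (C : AtomicDiagramCoding L) : Prop :=
  ∀ (n : ℕ) (φ : L.Formula (Fin n)), BoundedFormula.IsAtomic φ → φ ∈ C.level n

open Classical in
/-- The finite atomic diagram of a tuple. -/
noncomputable def AtomicDiagramCoding.diagram {L : FirstOrder.Language.{u, v}} (C : AtomicDiagramCoding L)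
    {A : Type w} [L.Structure A] {n : ℕ} (a : Fin n → A) : Finset (L.Formula (Fin n)) :=
  (C.level n).filter fun φ => Formula.Realize φ a

/-! ## Labeled trees and the tree of tuples -/

/-- The function symbols of the vocabulary of labeled trees. -/
inductive LabeledTreeFunctions : ℕ → Type
  | parent : LabeledTreeFunctions 1

/-- The relation symbols of the vocabulary of labeled trees: `le x y` says that `y` lies above
(extends) `x`, and `label c x` says that the label of `x` is `c`. -/
inductive LabeledTreeRelations : ℕ → Type
  | le : LabeledTreeRelations 2
  | label (c : ℕ) : LabeledTreeRelations 1

/-- The vocabulary of trees with a parent function and with labels in `ℕ`. -/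
def labeledTreeLanguage : FirstOrder.Language.{0, 0} :=
  ⟨LabeledTreeFunctions, LabeledTreeRelations⟩

/-- The nodes of the tree of tuples of `A`, where every branch is replicated infinitely often: a
node `(a_0, k_0), …, (a_{n-1}, k_{n-1})` is a copy of the tuple `a_0, …, a_{n-1}`, and
`k_0, …, k_{n-1}` say which copy is taken at each step. -/
def TreeOfTuples {L : FirstOrder.Language.{u, v}} (_C : AtomicDiagramCoding L) (A : Type w) : Type w :=
  List (A × ℕ)

/-- The sequence of pairs that makes up a node. -/
def TreeOfTuples.toList {L : FirstOrder.Language.{u, v}} {C : AtomicDiagramCoding L} {A : Type w}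
    (σ : TreeOfTuples C A) : List (A × ℕ) := σ

/-- The tuple of which a node is a copy. -/
def TreeOfTuples.tuple {L : FirstOrder.Language.{u, v}} {C : AtomicDiagramCoding L} {A : Type w}
    (σ : TreeOfTuples C A) : Fin σ.toList.length → A :=
  fun i => (σ.toList.get i).1

/-- The parent of a node; by convention the root is its own parent. -/
def TreeOfTuples.parent {L : FirstOrder.Language.{u, v}} {C : AtomicDiagramCoding L} {A : Type w}
    (σ : TreeOfTuples C A) : TreeOfTuples C A :=
  σ.toList.dropLast

/-- The label of a copy of a tuple: the code of the length and the finite atomic diagram. -/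
noncomputable def TreeOfTuples.label {L : FirstOrder.Language.{u, v}} {C : AtomicDiagramCoding L}
    {A : Type w} [L.Structure A] (σ : TreeOfTuples C A) : ℕ :=
  C.code ⟨σ.toList.length, C.diagram σ.tuple⟩

/-- The tree of tuples of `A` as a labeled tree. -/
noncomputable instance TreeOfTuples.instStructure {L : FirstOrder.Language.{u, v}}
    (C : AtomicDiagramCoding L) (A : Type w) [L.Structure A] :
    labeledTreeLanguage.Structure (TreeOfTuples C A) where
  funMap {_} f x :=
    match f, x with
    | .parent, x => (x 0).parent
  RelMap {_} r x :=
    match r, x with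
    | .le, x => (x 0).toList <+: (x 1).toList
    | .label c, x => (x 0).label = c

/-- Over a countable vocabulary there is a convention for coding finite atomic diagrams. -/
theorem AtomicDiagramCoding.nonempty (L : FirstOrder.Language.{u, v}) [Countable L.Symbols] :
    Nonempty (AtomicDiagramCoding L) := by
  classical
  obtain ⟨e, he⟩ := exists_injective_nat (Σ n, L.Formula (Fin n))
  obtain ⟨c, hc⟩ := exists_injective_nat (Σ n : ℕ, Finset (L.Formula (Fin n)))
  have comp : ∀ {l m n : ℕ} (h₁ : l ≤ m) (h₂ : m ≤ n) (φ : L.Formula (Fin l)),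
      BoundedFormula.IsAtomic φ →
      Formula.relabel (Fin.castLE h₂) (Formula.relabel (Fin.castLE h₁) φ) =
        Formula.relabel (Fin.castLE (h₁.trans h₂)) φ := by
    intro l m n h₁ h₂ φ hφ
    have key : BoundedFormula.relabelAux (Sum.inl ∘ Fin.castLE h₂ : Fin m → Fin n ⊕ Fin 0) 0 ∘
        BoundedFormula.relabelAux (Sum.inl ∘ Fin.castLE h₁ : Fin l → Fin m ⊕ Fin 0) 0 =
        BoundedFormula.relabelAux
          (Sum.inl ∘ Fin.castLE (h₁.trans h₂) : Fin l → Fin n ⊕ Fin 0) 0 := by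
      funext x
      rcases x with x | x
      · rfl
      · exact x.elim0
    cases hφ with
    | equal t₁ t₂ =>
      simp only [Formula.relabel, Term.bdEqual, BoundedFormula.relabel,
        BoundedFormula.mapTermRel]
      congr 1 <;> exact (Term.relabel_relabel _ _ _).trans (by rw [key])
    | rel R ts =>
      simp only [Formula.relabel, Relations.boundedFormula, BoundedFormula.relabel,
        BoundedFormula.mapTermRel, id]
      congr 1
      funext i
      exact (Term.relabel_relabel _ _ _).trans (by rw [key])
  let S : ∀ n : ℕ, Set (L.Formula (Fin n)) := fun n =>
    {ψ | ∃ (m : ℕ) (h : m ≤ n) (φ : L.Formula (Fin m)), BoundedFormula.IsAtomic φ ∧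
      e ⟨m, φ⟩ < n ∧ Formula.relabel (Fin.castLE h) φ = ψ}
  have hS : ∀ n, (S n).Finite := by
    intro n
    have hfin : {p : Σ n, L.Formula (Fin n) | e p < n}.Finite :=
      (Set.finite_lt_nat n).preimage he.injOn
    refine (hfin.image fun p => if h : p.1 ≤ n then Formula.relabel (Fin.castLE h) p.2 else ⊥).subset ?_
    rintro ψ ⟨m, h, φ, -, hlt, rfl⟩
    exact ⟨⟨m, φ⟩, hlt, by simp [h]⟩
  refine ⟨⟨fun n => (hS n).toFinset, ?_, ?_, ?_, c, hc⟩⟩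
  · intro n ψ hψ
    obtain ⟨m, h, φ, ha, -, rfl⟩ := (hS n).mem_toFinset.1 hψ
    exact ha.relabel _
  · intro m n h ψ hψ
    obtain ⟨l, h', φ, ha, hlt, rfl⟩ := (hS m).mem_toFinset.1 hψ
    exact (hS n).mem_toFinset.2 ⟨l, h'.trans h, φ, ha, hlt.trans_le h, (comp _ _ _ ha).symm⟩
  · intro m φ ha
    refine ⟨max m (e ⟨m, φ⟩ + 1), le_max_left _ _, (hS _).mem_toFinset.2
      ⟨m, le_max_left _ _, φ, ha, ?_, rfl⟩⟩
    exact lt_of_lt_of_le (Nat.lt_succ_self _) (le_max_right _ _)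

/-! ## Infinitary formulas: negation and invariance -/

/-! For α ≥ 1, all orbits are Σ_α-definable exactly when each is isolated by a back-and-forth type:
for every a there are a finite c and some β < α such that (a,c) ≤_β (b,d) forces b into the orbit of
a (`exists_orbitIsolated`, `OrbitIsolated.exists_isSigma`). Here ≤_β is `BackForth` over equality of
finite diagrams for A, and over `TreeRel` for the tree. A finite diagram sees only finitely many
atomic formulas, so a given quantifier-free formula is controlled only after padding the tuples
(`QFDetermined`). Padding costs no level: it is appended to a move or to c.

The two structures are compared at the same level β. One node above a given node codes a whole tuple
of A, so ≤_β between nodes gives ≤_β between their tuples (`BackForth.listDiagram_of_treeRel`).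
Conversely, one move in A plays all entries of finitely many nodes, and the answer is substituted
back into the nodes (`BackForth.treeRel_of_listDiagram`).

The orbits are compared as follows. Since branches are replicated infinitely often, two finite
families of nodes are automorphic once their shapes agree and each node separately copies a tuple
automorphic to that of its partner; no common automorphism of A is needed
(`TreeAutRel.exists_insert`). Conversely, a tree automorphism sends copies of a only to copies of
tuples in the orbit of a (`exists_equiv_of_treeEquiv`).

Ranks exist because the relations ≤_β on a countable structure stabilize, and a stable one is a
symmetric back-and-forth system. At rank 0 there is no c to absorb the padding: a label may fail to
determine the quantifier-free type of its tuple, unless the diagrams are full. -/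

/-- The opposite side of the hierarchy. -/
def FormulaSide.dual : FormulaSide → FormulaSide
  | .sigma => .pi
  | .pi => .sigma

section Formulas

variable {L : FirstOrder.Language.{u, v}} {M : Type w} [L.Structure M]

theorem InfFormula.InClass.exists_not {s : FormulaSide} {α : Ordinal.{0}} {n : ℕ}
    {φ : InfFormula L n} (h : φ.InClass s α) :
    ∃ ψ : InfFormula L n, ψ.InClass s.dual α ∧
      ∀ x : Fin n → M, ψ.Realize x ↔ ¬ φ.Realize x := by
  induction h with
  | qf s φ h => exact ⟨.qf φ.not h.not, .qf _ _ _, fun x => by simp [InfFormula.Realize]⟩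
  | disjEx k φ β hβ _ ih =>
    choose ψ hψ hn using ih
    exact ⟨.conjAll k ψ, .conjAll k ψ β hβ hψ, fun x => by simp [InfFormula.Realize, hn]⟩
  | conjAll k φ β hβ _ ih =>
    choose ψ hψ hn using ih
    exact ⟨.disjEx k ψ, .disjEx k ψ β hβ hψ, fun x => by simp [InfFormula.Realize, hn]⟩

theorem Fin.append_comp {M N : Type*} {m n : ℕ} (f : M → N) (x : Fin m → M) (y : Fin n → M) :
    f ∘ Fin.append x y = Fin.append (f ∘ x) (f ∘ y) := by
  funext i
  refine Fin.addCases (fun i => ?_) (fun i => ?_) i <;> simp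

theorem InfFormula.realize_equiv (f : M ≃[L] M) {n : ℕ} (φ : InfFormula L n) (x : Fin n → M) :
    φ.Realize (f ∘ x) ↔ φ.Realize x := by
  induction φ with
  | qf φ h => exact StrongHomClass.realize_formula f φ
  | disjEx k φ ih =>
    refine exists_congr fun i => ⟨fun ⟨y, hy⟩ => ⟨f.symm ∘ y, ?_⟩, fun ⟨y, hy⟩ => ⟨f ∘ y, ?_⟩⟩
    · rw [← ih, Fin.append_comp, ← Function.comp_assoc]
      convert hy
      funext z
      simp
    · rw [← Fin.append_comp]
      exact (ih i _).2 hy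
  | conjAll k φ ih =>
    refine forall_congr' fun i => ⟨fun H y => ?_, fun H y => ?_⟩
    · rw [← ih, Fin.append_comp]
      exact H _
    · have := (ih i _).2 (H (f.symm ∘ y))
      rw [Fin.append_comp, ← Function.comp_assoc] at this
      convert this
      funext z
      simp

theorem InfFormula.realize_of_mem_autOrbit {n : ℕ} {φ : InfFormula L n} {a b : Fin n → M}
    (hb : b ∈ autOrbit L a) (ha : φ.Realize a) : φ.Realize b := by
  obtain ⟨f, hf⟩ := hb
  have : b = f ∘ a := funext fun i => (hf i).symm
  rw [this]
  exact (InfFormula.realize_equiv f φ a).2 ha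

/-- In `InClass` a bare quantifier-free formula has level 0 only, so reaching level 1 takes an empty
quantifier block and a constant disjunction. -/
theorem OrbitsSigmaDefinable.one_of_zero (h : OrbitsSigmaDefinable L M 0) :
    OrbitsSigmaDefinable L M 1 := by
  intro n a
  obtain ⟨φ, hφ, hr⟩ := h n a
  obtain ⟨φ', hφ'⟩ : ∃ φ' : InfFormula L n, φ'.InClass .pi 0 ∧
      ∀ b : Fin n → M, φ'.Realize b ↔ φ.Realize b := by
    cases hφ with
    | qf _ ψ hq => exact ⟨.qf ψ hq, .qf _ _ _, fun _ => Iff.rfl⟩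
    | disjEx k φ β hβ _ => exact absurd (hβ 0) not_lt_zero
  refine ⟨.disjEx (fun _ => 0) (fun _ => φ'), .disjEx _ _ (fun _ => 0)
    (fun _ => zero_lt_one) (fun _ => hφ'.1), fun b => ?_⟩
  rw [← hr, ← hφ'.2]
  refine ⟨fun ⟨_, y, hy⟩ => ?_, fun hb => ⟨0, Fin.elim0, ?_⟩⟩
  · rwa [Fin.append_right_nil _ _ rfl] at hy
  · rwa [Fin.append_right_nil _ _ rfl]

/-- Handles empty `A`, whose tree is just the root; elsewhere an element is needed for padding. -/
theorem orbitsSigmaDefinable_of_subsingleton [Subsingleton M] (α : Ordinal.{0}) :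
    OrbitsSigmaDefinable L M α := by
  have horb : ∀ {n : ℕ} (a b : Fin n → M), b ∈ autOrbit L a := fun a b =>
    ⟨FirstOrder.Language.Equiv.refl L M, fun i => Subsingleton.elim _ _⟩
  intro n a
  have hT : (⊤ : L.Formula (Fin n)).IsQF := BoundedFormula.IsQF.top
  have hT' : ∀ k, (⊤ : L.Formula (Fin k)).IsQF := fun k => BoundedFormula.IsQF.top
  rcases eq_or_ne α 0 with rfl | hα
  · exact ⟨.qf ⊤ hT, .qf _ _ _, fun b => by simp [InfFormula.Realize, horb a b]⟩
  · refine ⟨.disjEx (fun _ => 0) (fun _ => .qf ⊤ (hT' _)), .disjEx _ _ (fun _ => 0)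
      (fun _ => pos_iff_ne_zero.2 hα) (fun _ => .qf _ _ _), fun b => ?_⟩
    simp only [horb a b, iff_true]
    exact ⟨0, Fin.elim0, by simp [InfFormula.Realize]⟩

/-- Finitely many quantifier-free conditions on a tuple are expressed by one formula. -/
theorem exists_isQF_iff_of_finite {n : ℕ} {Φ : Set (L.Formula (Fin n))} (hΦ : Φ.Finite)
    (hq : ∀ φ ∈ Φ, BoundedFormula.IsQF φ) (a : Fin n → M) :
    ∃ θ : L.Formula (Fin n), θ.IsQF ∧ θ.Realize a ∧
      ∀ b : Fin n → M, θ.Realize b → ∀ φ ∈ Φ, (Formula.Realize φ a ↔ Formula.Realize φ b) := by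
  induction Φ, hΦ using Set.Finite.induction_on with
  | empty => exact ⟨⊤, BoundedFormula.IsQF.top, by simp, by simp⟩
  | @insert φ Φ _ _ ih =>
    obtain ⟨θ, h1, h2, h3⟩ := ih fun φ hφ => hq φ (Set.mem_insert_of_mem _ hφ)
    have hφ := hq φ (Set.mem_insert _ _)
    by_cases ha : Formula.Realize φ a
    · refine ⟨θ ⊓ φ, h1.inf hφ, by simp [h2, ha], fun b hb => ?_⟩
      rw [Formula.realize_inf] at hb
      rintro ψ (rfl | hψ)
      · exact iff_of_true ha hb.2
      · exact h3 b hb.1 ψ hψ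
    · refine ⟨θ ⊓ φ.not, h1.inf hφ.not, by simp [h2, ha], fun b hb => ?_⟩
      rw [Formula.realize_inf, Formula.realize_not] at hb
      rintro ψ (rfl | hψ)
      · exact iff_of_false ha hb.2
      · exact h3 b hb.1 ψ hψ

end Formulas

/-! ## Back-and-forth relations -/

section BackForth

variable {L : FirstOrder.Language.{u, v}} {M : Type w}

/-- The back-and-forth relations between finite sequences over the base relation `r`. -/
def BackForth (r : List M → List M → Prop) (β : Ordinal.{0}) (a b : List M) : Prop :=
  r a b ∧ ∀ γ < β, ∀ d : List M, ∃ c : List M, c.length = d.length ∧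
    BackForth r γ (b ++ d) (a ++ c)
termination_by β

theorem backForth_iff {r : List M → List M → Prop} {β : Ordinal.{0}} {a b : List M} :
    BackForth r β a b ↔ r a b ∧ ∀ γ < β, ∀ d : List M, ∃ c : List M, c.length = d.length ∧
      BackForth r γ (b ++ d) (a ++ c) := by
  rw [BackForth]

theorem BackForth.base {r : List M → List M → Prop} {β : Ordinal.{0}} {a b : List M}
    (h : BackForth r β a b) : r a b :=
  (backForth_iff.1 h).1

theorem BackForth.mono {r : List M → List M → Prop} {β γ : Ordinal.{0}} (hγ : γ ≤ β)
    {a b : List M} (h : BackForth r β a b) : BackForth r γ a b :=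
  backForth_iff.2 ⟨h.base, fun δ hδ => (backForth_iff.1 h).2 δ (hδ.trans_le hγ)⟩

/-- The relation with a tuple is implied by a quantifier-free formula true of the tuple. -/
def QFIsolated (L : FirstOrder.Language.{u, v}) {M : Type w} [L.Structure M]
    (r : List M → List M → Prop) : Prop :=
  ∀ (n : ℕ) (a : Fin n → M), ∃ φ : L.Formula (Fin n), φ.IsQF ∧ φ.Realize a ∧
    ∀ b : Fin n → M, φ.Realize b → r (List.ofFn a) (List.ofFn b)

/-- A quantifier-free formula cannot separate tuples that have related long extensions. -/
def QFDetermined (L : FirstOrder.Language.{u, v}) {M : Type w} [L.Structure M]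
    (r : List M → List M → Prop) : Prop :=
  ∀ (n : ℕ) (φ : L.Formula (Fin n)), φ.IsQF → ∃ m : ℕ, ∀ (a b : Fin n → M) (c d : List M),
    m ≤ c.length → c.length = d.length → r (List.ofFn a ++ c) (List.ofFn b ++ d) →
      (φ.Realize a ↔ φ.Realize b)

theorem List.exists_ofFn {M : Type*} {n : ℕ} {l : List M} (h : l.length = n) :
    ∃ x : Fin n → M, l = List.ofFn x := by
  subst h
  exact ⟨l.get, (List.ofFn_get l).symm⟩

variable [L.Structure M]

/-- The converse of preservation. Countability of `M` lets a single conjunction contain, for each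
unrelated `b`, one conjunct that holds at `a` and fails at `b`. -/
theorem exists_pi_backForth [Countable M] {r : List M → List M → Prop} (hr : QFIsolated L r)
    (β : Ordinal.{0}) : ∀ (n : ℕ) (a : Fin n → M), ∃ φ : InfFormula L n, φ.InClass .pi β ∧
      φ.Realize a ∧ ∀ b : Fin n → M, φ.Realize b → BackForth r β (List.ofFn a) (List.ofFn b) := by
  induction β using WellFoundedLT.induction with
  | _ β ih =>
  intro n a
  obtain ⟨θ, hθ, hθa, hθr⟩ := hr n a
  rcases eq_or_ne β 0 with rfl | hβ
  · exact ⟨.qf θ hθ, .qf _ _ _, hθa, fun b hb =>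
      backForth_iff.2 ⟨hθr b hb, fun γ hγ => absurd hγ not_lt_zero⟩⟩
  have key : ∀ b : Fin n → M, ∃ (k : ℕ) (χ : InfFormula L (n + k)) (γ : Ordinal.{0}),
      γ < β ∧ χ.InClass .sigma γ ∧ (∀ y, χ.Realize (Fin.append a y)) ∧
      ((∀ y, χ.Realize (Fin.append b y)) → BackForth r β (List.ofFn a) (List.ofFn b)) := by
    intro b
    by_cases hrb : r (List.ofFn a) (List.ofFn b)
    · by_cases hb : BackForth r β (List.ofFn a) (List.ofFn b)
      · exact ⟨0, .qf ⊤ BoundedFormula.IsQF.top, 0, pos_iff_ne_zero.2 hβ, .qf _ _ _,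
          fun y => by simp [InfFormula.Realize], fun _ => hb⟩
      rw [backForth_iff] at hb
      push Not at hb
      obtain ⟨γ, hγ, d, hd⟩ := hb hrb
      -- The challenge `d` cannot be answered over `a`. So the negation of the Π_γ formula of (b,d)
      -- holds at every (a,y) and fails at (b,d).
      obtain ⟨ψ, hψ, hψd, hψr⟩ := ih γ hγ (n + d.length) (Fin.append b d.get)
      obtain ⟨χ, hχ, hχn⟩ := hψ.exists_not (M := M)
      refine ⟨d.length, χ, γ, hγ, hχ, fun y => ?_, fun hy => ?_⟩
      · rw [hχn]
        intro hψy
        have := hψr _ hψy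
        rw [List.ofFn_fin_append, List.ofFn_fin_append, List.ofFn_get] at this
        exact hd (List.ofFn y) (by simp) this
      · exact absurd hψd ((hχn _).1 (hy d.get))
    · refine ⟨0, .qf θ hθ, 0, pos_iff_ne_zero.2 hβ, .qf _ _ _, fun y => ?_, fun hy => ?_⟩
      · rw [Fin.append_right_nil _ _ rfl]
        exact hθa
      · have := hy Fin.elim0
        rw [Fin.append_right_nil _ _ rfl] at this
        exact absurd (hθr b this) hrb
  choose k χ γ hγ hχ h1 h2 using key
  have : Nonempty (Fin n → M) := ⟨a⟩
  obtain ⟨g, hg⟩ := exists_surjective_nat (Fin n → M)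
  refine ⟨.conjAll (fun i => k (g i)) (fun i => χ (g i)), .conjAll _ _ (fun i => γ (g i))
    (fun i => hγ _) (fun i => hχ _), fun i y => h1 _ y, fun b hb => ?_⟩
  obtain ⟨i, rfl⟩ := hg b
  exact h2 _ fun y => hb i y

/-- Π formulas pass from left to right and Σ formulas from right to left, since each move swaps the
sides. The padding length `m` is positive at most for quantifier-free formulas; above level 0 the
padding travels inside the move. -/
theorem InfFormula.InClass.preserved [Nonempty M] {r : List M → List M → Prop}
    (hr : QFDetermined L r) {s : FormulaSide} {β : Ordinal.{0}} {n : ℕ} {φ : InfFormula L n}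
    (h : φ.InClass s β) : ∃ m : ℕ, ∀ (a b : Fin n → M) (c d : List M), c.length = m →
      d.length = m → BackForth r β (List.ofFn a ++ c) (List.ofFn b ++ d) →
      (s = .pi → φ.Realize a → φ.Realize b) ∧ (s = .sigma → φ.Realize b → φ.Realize a) := by
  have z : M := Classical.arbitrary M
  induction h with
  | qf s φ h =>
    obtain ⟨m, hm⟩ := hr _ φ h
    refine ⟨m, fun a b c d h1 h2 H => ?_⟩
    have := hm a b c d h1.ge (h1.trans h2.symm) H.base
    exact ⟨fun _ => this.1, fun _ => this.2⟩
  | @disjEx α n k φ β hβ _ ih =>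
    refine ⟨0, fun a b c d hc hd H => ⟨nofun, fun _ => ?_⟩⟩
    obtain rfl := List.length_eq_zero_iff.1 hc
    obtain rfl := List.length_eq_zero_iff.1 hd
    rw [List.append_nil, List.append_nil] at H
    rintro ⟨i, y, hy⟩
    obtain ⟨m, hm⟩ := ih i
    -- The witness is played together with the padding its matrix needs; the first `k i` entries of
    -- the answer are the new witness.
    obtain ⟨c', hc', H'⟩ := (backForth_iff.1 H).2 _ (hβ i) (List.ofFn y ++ List.replicate m z)
    obtain ⟨x, hx⟩ := List.exists_ofFn (l := c'.take (k i)) (n := k i) (by simp [hc'])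
    rw [← List.take_append_drop (k i) c', hx, ← List.append_assoc, ← List.append_assoc,
      ← List.ofFn_fin_append, ← List.ofFn_fin_append] at H'
    exact ⟨i, x, (hm _ _ _ _ (by simp) (by simp [hc']) H').1 rfl hy⟩
  | @conjAll α n k φ β hβ _ ih =>
    refine ⟨0, fun a b c d hc hd H => ⟨fun _ => ?_, nofun⟩⟩
    obtain rfl := List.length_eq_zero_iff.1 hc
    obtain rfl := List.length_eq_zero_iff.1 hd
    rw [List.append_nil, List.append_nil] at H
    intro ha i y
    obtain ⟨m, hm⟩ := ih i
    obtain ⟨c', hc', H'⟩ := (backForth_iff.1 H).2 _ (hβ i) (List.ofFn y ++ List.replicate m z)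
    obtain ⟨x, hx⟩ := List.exists_ofFn (l := c'.take (k i)) (n := k i) (by simp [hc'])
    rw [← List.take_append_drop (k i) c', hx, ← List.append_assoc, ← List.append_assoc,
      ← List.ofFn_fin_append, ← List.ofFn_fin_append] at H'
    exact (hm _ _ _ _ (by simp) (by simp [hc']) H').2 rfl (ha i x)

/-- The orbit of `a` is isolated by the back-and-forth type of level `β` of an extension of `a`. -/
def OrbitIsolated (L : FirstOrder.Language.{u, v}) {M : Type w} [L.Structure M]
    (r : List M → List M → Prop) (β : Ordinal.{0}) {n : ℕ} (a : Fin n → M) : Prop :=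
  ∃ c : List M, ∀ (b : Fin n → M) (d : List M), d.length = c.length →
    BackForth r β (List.ofFn a ++ c) (List.ofFn b ++ d) → b ∈ autOrbit L a

theorem OrbitIsolated.exists_isSigma [Countable M] {r : List M → List M → Prop}
    (hr : QFIsolated L r) {α β : Ordinal.{0}} (hβ : β < α) {n : ℕ} {a : Fin n → M}
    (h : OrbitIsolated L r β a) : ∃ φ : InfFormula L n, φ.IsSigma α ∧
      ∀ b : Fin n → M, φ.Realize b ↔ b ∈ autOrbit L a := by
  obtain ⟨c, hc⟩ := h
  obtain ⟨φ, hφ, hφa, hφr⟩ := exists_pi_backForth hr β (n + c.length) (Fin.append a c.get)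
  refine ⟨.disjEx (fun _ => c.length) (fun _ => φ), .disjEx _ _ (fun _ => β) (fun _ => hβ)
    (fun _ => hφ), fun b => ⟨fun ⟨_, y, hy⟩ => ?_, fun hb => ?_⟩⟩
  · have := hφr _ hy
    rw [List.ofFn_fin_append, List.ofFn_fin_append, List.ofFn_get] at this
    exact hc b (List.ofFn y) (by simp) this
  · obtain ⟨f, hf⟩ := hb
    refine ⟨0, f ∘ c.get, ?_⟩
    have : b = f ∘ a := funext fun i => (hf i).symm
    rw [this, ← Fin.append_comp]
    exact (InfFormula.realize_equiv f φ _).2 hφa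

theorem exists_orbitIsolated [Nonempty M] {r : List M → List M → Prop} (hr : QFDetermined L r)
    {α : Ordinal.{0}} (hα : α ≠ 0) (h : OrbitsSigmaDefinable L M α) {n : ℕ} (a : Fin n → M) :
    ∃ β < α, OrbitIsolated L r β a := by
  have z : M := Classical.arbitrary M
  obtain ⟨φ, hφ, hφa⟩ := h n a
  cases hφ with
  | qf => exact absurd rfl hα
  | disjEx k φ β hβ hφ =>
    obtain ⟨i, y, hy⟩ := (hφa a).2 ⟨FirstOrder.Language.Equiv.refl L M, fun _ => rfl⟩
    obtain ⟨m, hm⟩ := (hφ i).preserved hr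
    refine ⟨β i, hβ i, List.ofFn y ++ List.replicate m z, fun b d hd H => ?_⟩
    obtain ⟨x, hx⟩ := List.exists_ofFn (l := d.take (k i)) (n := k i) (by simp [hd])
    rw [← List.take_append_drop (k i) d, hx, ← List.append_assoc, ← List.append_assoc,
      ← List.ofFn_fin_append, ← List.ofFn_fin_append] at H
    exact (hφa b).1 ⟨i, x, (hm _ _ _ _ (by simp) (by simp [hd]) H).1 rfl hy⟩

/-! ### Automorphisms from back-and-forth systems, and stabilization -/

/-- A symmetric back-and-forth system on a countable structure is realized by automorphisms. -/
theorem exists_equiv_of_forth [Countable M] {r E : List M → List M → Prop}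
    (hr : QFDetermined L r) (hEr : ∀ x y, E x y → r x y)
    (hlen : ∀ x y, E x y → x.length = y.length) (hsymm : ∀ x y, E x y → E y x)
    (hforth : ∀ x y, E x y → ∀ d, ∃ c, E (x ++ [d]) (y ++ [c])) {x₀ y₀ : List M}
    (h₀ : E x₀ y₀) : ∃ f : M ≃[L] M, x₀.map f = y₀ := by
  rcases isEmpty_or_nonempty M with hM | hM
  · refine ⟨FirstOrder.Language.Equiv.refl L M, Subsingleton.elim _ _⟩
  obtain ⟨g, hg⟩ := exists_surjective_nat M
  -- One round puts `d` into the domain, answered by `v`, and into the range, answered by `u`.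
  have step : ∀ (p : {p : List M × List M // E p.1 p.2}) (d : M),
      ∃ q : {p : List M × List M // E p.1 p.2}, ∃ u v : M,
        q.1.1 = p.1.1 ++ [d, u] ∧ q.1.2 = p.1.2 ++ [v, d] := by
    rintro ⟨⟨x, y⟩, h⟩ d
    obtain ⟨v, hv⟩ := hforth _ _ h d
    obtain ⟨u, hu⟩ := hforth _ _ (hsymm _ _ hv) d
    exact ⟨⟨(x ++ [d] ++ [u], y ++ [v] ++ [d]), hsymm _ _ hu⟩, u, v, by simp, by simp⟩
  choose next u v hnext1 hnext2 using step
  let s : ℕ → {p : List M × List M // E p.1 p.2} :=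
    fun i => Nat.rec ⟨(x₀, y₀), h₀⟩ (fun i p => next p (g i)) i
  have s1 : ∀ i, (s (i + 1)).1.1 = (s i).1.1 ++ [g i, u (s i) (g i)] := fun i => hnext1 _ _
  have s2 : ∀ i, (s (i + 1)).1.2 = (s i).1.2 ++ [v (s i) (g i), g i] := fun i => hnext2 _ _
  have slen : ∀ i, (s i).1.1.length = (s i).1.2.length := fun i => hlen _ _ (s i).2
  -- Later stages supply the arbitrarily long related extensions that `QFDetermined` asks for.
  have sext : ∀ i j, ∃ c d, j ≤ c.length ∧ c.length = d.length ∧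
      (s (i + j)).1.1 = (s i).1.1 ++ c ∧ (s (i + j)).1.2 = (s i).1.2 ++ d := by
    intro i j
    induction j with
    | zero => exact ⟨[], [], by simp⟩
    | succ j ih =>
      obtain ⟨c, d, h1, h2, h3, h4⟩ := ih
      refine ⟨c ++ [g (i + j), u (s (i + j)) (g (i + j))],
        d ++ [v (s (i + j)) (g (i + j)), g (i + j)], ?_, ?_, ?_, ?_⟩
      · simp; omega
      · simpa using h2
      · rw [← add_assoc, s1, h3, List.append_assoc]
      · rw [← add_assoc, s2, h4, List.append_assoc]
  let P : M × M → Prop := fun p => ∃ i, p ∈ (s i).1.1.zip (s i).1.2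
  have zmono : ∀ i j, i ≤ j → ∀ p, p ∈ (s i).1.1.zip (s i).1.2 → p ∈ (s j).1.1.zip (s j).1.2 := by
    intro i j hij p hp
    obtain ⟨k, rfl⟩ := Nat.exists_eq_add_of_le hij
    obtain ⟨c, d, -, -, h3, h4⟩ := sext i k
    rw [h3, h4, List.zip_append (slen i)]
    exact List.mem_append_left _ hp
  have hP1 : ∀ a, ∃ b, P (a, b) := by
    intro a
    obtain ⟨i, rfl⟩ := hg a
    refine ⟨v (s i) (g i), i + 1, ?_⟩
    rw [s1, s2, List.zip_append (slen i)]
    simp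
  have hP2 : ∀ b, ∃ a, P (a, b) := by
    intro a
    obtain ⟨i, rfl⟩ := hg a
    refine ⟨u (s i) (g i), i + 1, ?_⟩
    rw [s1, s2, List.zip_append (slen i)]
    simp
  -- The formula is relabeled to speak of a whole stage, whose two sides are then padded by a later
  -- stage.
  have agree : ∀ {n : ℕ} (φ : L.Formula (Fin n)), φ.IsQF → ∀ a b : Fin n → M,
      (∀ i, P (a i, b i)) → (φ.Realize a ↔ φ.Realize b) := by
    intro n φ hφ a b hab
    choose t ht using hab
    obtain ⟨T, hT⟩ : ∃ T, ∀ i, t i ≤ T :=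
      ⟨Finset.univ.sup t, fun i => Finset.le_sup (f := t) (Finset.mem_univ i)⟩
    have hab : ∀ i, (a i, b i) ∈ (s T).1.1.zip (s T).1.2 := fun i => zmono _ _ (hT i) _ (ht i)
    obtain ⟨N, hN⟩ : ∃ N, (s T).1.1.length = N := ⟨_, rfl⟩
    obtain ⟨x, hx⟩ := List.exists_ofFn hN
    obtain ⟨y, hy⟩ := List.exists_ofFn ((slen T).symm.trans hN)
    have : ∀ i, ∃ j, x j = a i ∧ y j = b i := by
      intro i
      obtain ⟨j, hj, hj'⟩ := List.mem_iff_getElem.1 (hab i)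
      have hjN : j < N := by
        rw [List.length_zip] at hj
        omega
      refine ⟨⟨j, hjN⟩, ?_⟩
      rw [List.getElem_zip] at hj'
      simp only [hx, hy, List.getElem_ofFn, Prod.mk.injEq] at hj'
      exact hj'
    choose q hq1 hq2 using this
    obtain ⟨m, hm⟩ := hr N (φ.relabel q) (hφ.relabel _)
    obtain ⟨c, d, h1, h2, h3, h4⟩ := sext T m
    have := hEr _ _ (s (T + m)).2
    rw [h3, h4, hx, hy] at this
    have := hm x y c d h1 h2 this
    rw [Formula.realize_relabel, Formula.realize_relabel] at this
    rwa [show x ∘ q = a from funext hq1, show y ∘ q = b from funext hq2] at this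
  have heq : ∀ {a b a' b'}, P (a, b) → P (a', b') → (a = a' ↔ b = b') := by
    intro a b a' b' h h'
    have := agree (Term.equal (Term.var 0) (Term.var 1) : L.Formula (Fin 2))
      (BoundedFormula.IsAtomic.equal _ _).isQF ![a, a'] ![b, b']
      (by intro i; fin_cases i <;> simpa)
    simpa [Formula.realize_equal] using this
  choose F hF using hP1
  choose G hG using hP2
  let e : M ≃ M := ⟨F, G, fun a => (heq (hG _) (hF _)).2 rfl, fun b => (heq (hF _) (hG _)).1 rfl⟩
  refine ⟨{ toEquiv := e, map_fun' := ?_, map_rel' := ?_ }, ?_⟩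
  · intro n f x
    have := agree (Term.equal (Term.func f fun i : Fin n => Term.var i.succ)
      (Term.var 0) : L.Formula (Fin (n + 1))) (BoundedFormula.IsAtomic.equal _ _).isQF
      (Fin.cons (Structure.funMap f x) x) (Fin.cons (F (Structure.funMap f x)) (F ∘ x))
      (Fin.cases (hF _) fun i => hF _)
    simp only [Formula.realize_equal, Term.realize_func, Term.realize_var, Fin.cons_succ,
      Fin.cons_zero, true_iff] at this
    exact this.symm
  · intro n R x
    have := agree (R.formula fun i : Fin n => Term.var i) (BoundedFormula.IsAtomic.rel _ _).isQF
      x (F ∘ x) (fun i => hF _)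
    rw [Formula.realize_rel, Formula.realize_rel] at this
    exact this.symm
  · refine List.ext_getElem ((List.length_map _).trans (slen 0)) fun i h1 h2 => ?_
    rw [List.length_map] at h1
    have hz : (x₀[i], y₀[i]) ∈ x₀.zip y₀ :=
      List.mem_iff_getElem.2 ⟨i, by simp [h1, h2], List.getElem_zip⟩
    rw [List.getElem_map]
    exact (heq (hF _) (⟨0, hz⟩ : P (x₀[i], y₀[i]))).1 rfl

theorem exists_backForth_stable [Countable M] (r : List M → List M → Prop) :
    ∃ β : Ordinal.{0}, ∀ a b, BackForth r β a b → BackForth r (β + 1) a b := by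
  obtain ⟨e, he⟩ := exists_injective_nat (List M × List M)
  -- Coding pairs by naturals places the relations in `Set ℕ`, which lies in the universe of the
  -- ordinals even if `M` does not.
  have := not_injective_of_ordinal.{0}
    fun β : Ordinal.{0} => e '' {p | BackForth r β p.1 p.2}
  simp only [Function.Injective, not_forall] at this
  obtain ⟨β, γ, h, hne⟩ := this
  replace h := he.image_injective h
  wlog hlt : β < γ generalizing β γ
  · exact this γ β (Ne.symm hne) h.symm (lt_of_le_of_ne (not_lt.1 hlt) (Ne.symm hne))
  refine ⟨β, fun a b hab => ?_⟩
  have : (a, b) ∈ {p : List M × List M | BackForth r γ p.1 p.2} := h ▸ hab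
  exact BackForth.mono (Order.add_one_le_of_lt hlt) this

/-- Orbits are isolated at the level where the back-and-forth relations stabilize. -/
theorem exists_forall_orbitIsolated [Countable M] {r : List M → List M → Prop}
    (hr : QFDetermined L r) (hlen : ∀ x y, r x y → x.length = y.length) :
    ∃ β : Ordinal.{0}, ∀ (n : ℕ) (a : Fin n → M), OrbitIsolated L r β a := by
  obtain ⟨β, hβ⟩ := exists_backForth_stable r
  have ext : ∀ x y, BackForth r β x y → ∀ d : List M, ∃ c : List M, c.length = d.length ∧
      BackForth r β (y ++ d) (x ++ c) := fun x y h d =>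
    (backForth_iff.1 (hβ x y h)).2 β (Order.lt_add_one_iff.2 le_rfl) d
  have symm : ∀ x y, BackForth r β x y → BackForth r β y x := by
    intro x y h
    -- The empty move swaps the sides without losing a level, which is symmetry.
    obtain ⟨c, hc, h⟩ := ext x y h []
    simpa [List.length_eq_zero_iff.1 hc] using h
  refine ⟨β, fun n a => ⟨[], fun b d hd h => ?_⟩⟩
  rw [List.length_eq_zero_iff.1 hd, List.append_nil, List.append_nil] at h
  obtain ⟨f, hf⟩ := exists_equiv_of_forth hr (fun _ _ h => h.base)
    (fun _ _ h => hlen _ _ h.base) symm (fun x y h d => by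
      obtain ⟨c, hc, h⟩ := ext y x (symm _ _ h) [d]
      obtain ⟨c, rfl⟩ := List.length_eq_one_iff.1 hc
      exact ⟨c, h⟩) h
  rw [List.map_ofFn] at hf
  exact ⟨f, congrFun (List.ofFn_injective hf)⟩

end BackForth

/-! ## Diagrams of finite sequences -/

section Diagrams

variable {L : FirstOrder.Language.{u, v}} {A : Type w} [L.Structure A]

theorem List.exists_of_mem_zip_ofFn {M N : Type*} {n : ℕ} {a : Fin n → M} {b : Fin n → N}
    {z : M × N} (hz : z ∈ (List.ofFn a).zip (List.ofFn b)) : ∃ i, z = (a i, b i) := by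
  obtain ⟨i, hi, rfl⟩ := List.mem_iff_getElem.1 hz
  simp only [List.length_zip, List.length_ofFn, min_self] at hi
  exact ⟨⟨i, hi⟩, by simp⟩

theorem QFDetermined.of_finite {M : Type w} [L.Structure M] {r : List M → List M → Prop}
    (hr : QFDetermined L r) {n : ℕ} {Φ : Set (L.Formula (Fin n))} (hΦ : Φ.Finite)
    (hq : ∀ φ ∈ Φ, BoundedFormula.IsQF φ) :
    ∃ m : ℕ, ∀ (a b : Fin n → M) (c d : List M), m ≤ c.length → c.length = d.length →
      r (List.ofFn a ++ c) (List.ofFn b ++ d) →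
        ∀ φ ∈ Φ, (Formula.Realize φ a ↔ Formula.Realize φ b) := by
  induction Φ, hΦ using Set.Finite.induction_on with
  | empty => exact ⟨0, by simp⟩
  | @insert φ Φ _ _ ih =>
    obtain ⟨m, hm⟩ := ih fun φ hφ => hq φ (Set.mem_insert_of_mem _ hφ)
    obtain ⟨k, hk⟩ := hr n φ (hq φ (Set.mem_insert _ _))
    refine ⟨max m k, fun a b c d hc hcd h => ?_⟩
    rintro ψ (rfl | hψ)
    · exact hk a b c d ((le_max_right _ _).trans hc) hcd h
    · exact hm a b c d ((le_max_left _ _).trans hc) hcd h ψ hψ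

theorem realize_iff_of_isQF {M : Type w} [L.Structure M] {n : ℕ} {a b : Fin n → M}
    (h : ∀ φ : L.Formula (Fin n), BoundedFormula.IsAtomic φ → (φ.Realize a ↔ φ.Realize b))
    {φ : L.Formula (Fin n)} (hφ : φ.IsQF) : φ.Realize a ↔ φ.Realize b := by
  induction hφ with
  | falsum => exact Iff.rfl
  | of_isAtomic hφ => exact h _ hφ
  | imp _ _ ih1 ih2 => exact imp_congr ih1 ih2

namespace AtomicDiagramCoding

variable (C : AtomicDiagramCoding L)

/-- The length and the finite atomic diagram of a finite sequence. -/
noncomputable def listDiagram (l : List A) : Σ n : ℕ, Finset (L.Formula (Fin n)) :=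
  ⟨l.length, C.diagram l.get⟩

theorem listDiagram_ofFn {n : ℕ} (a : Fin n → A) :
    C.listDiagram (List.ofFn a) = ⟨n, C.diagram a⟩ :=
  congrArg (fun p : Σ n, Fin n → A => (⟨p.1, C.diagram p.2⟩ : Σ n, Finset (L.Formula (Fin n))))
    (List.equivSigmaTuple.right_inv ⟨n, a⟩)

variable {C}

theorem length_eq_of_listDiagram_eq {x y : List A} (h : C.listDiagram x = C.listDiagram y) :
    x.length = y.length :=
  congrArg Sigma.fst h

theorem listDiagram_ofFn_eq_iff {n : ℕ} {a b : Fin n → A} :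
    C.listDiagram (List.ofFn a) = C.listDiagram (List.ofFn b) ↔
      ∀ φ ∈ C.level n, (Formula.Realize φ a ↔ Formula.Realize φ b) := by
  rw [listDiagram_ofFn, listDiagram_ofFn, Sigma.mk.injEq, heq_eq_eq]
  simp only [true_and, diagram]
  simp only [Finset.ext_iff, Finset.mem_filter, and_congr_right_iff]

theorem realize_relabel_castLE_append {m n : ℕ} (h : n ≤ n + m) (φ : L.Formula (Fin n))
    (a : Fin n → A) (c : Fin m → A) :
    (φ.relabel (Fin.castLE h)).Realize (Fin.append a c) ↔ φ.Realize a := by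
  rw [Formula.realize_relabel]
  have : Fin.append a c ∘ Fin.castLE h = a := funext fun i => Fin.append_left a c i
  rw [this]

/-- By `mono`, a recorded formula of the initial segment is also recorded for the longer sequence.
-/
theorem listDiagram_eq_of_append {x y c d : List A} (hxy : x.length = y.length)
    (h : C.listDiagram (x ++ c) = C.listDiagram (y ++ d)) :
    C.listDiagram x = C.listDiagram y := by
  obtain ⟨n, hn⟩ : ∃ n, x.length = n := ⟨_, rfl⟩
  obtain ⟨m, hm⟩ : ∃ m, c.length = m := ⟨_, rfl⟩
  have hl := length_eq_of_listDiagram_eq h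
  rw [List.length_append, List.length_append, hxy, add_right_inj] at hl
  obtain ⟨a, rfl⟩ := List.exists_ofFn hn
  obtain ⟨b, rfl⟩ := List.exists_ofFn (hxy.symm.trans hn)
  obtain ⟨c, rfl⟩ := List.exists_ofFn hm
  obtain ⟨d, rfl⟩ := List.exists_ofFn (hl.symm.trans hm)
  rw [← List.ofFn_fin_append, ← List.ofFn_fin_append, listDiagram_ofFn_eq_iff] at h
  rw [listDiagram_ofFn_eq_iff]
  intro φ hφ
  have := h _ (C.mono n (n + m) (Nat.le_add_right _ _) φ hφ)
  rwa [realize_relabel_castLE_append, realize_relabel_castLE_append] at this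

theorem listDiagram_take {x y : List A} (h : C.listDiagram x = C.listDiagram y) (n : ℕ) :
    C.listDiagram (x.take n) = C.listDiagram (y.take n) := by
  refine listDiagram_eq_of_append (c := x.drop n) (d := y.drop n) ?_ (by simpa using h)
  rw [List.length_take, List.length_take, length_eq_of_listDiagram_eq h]

/-- By `exhaustive`, an atomic formula is recorded once enough dummy variables are added; their
number is the padding. Longer padding is truncated. -/
theorem qfDetermined : QFDetermined L fun x y : List A => C.listDiagram x = C.listDiagram y := by
  intro n φ hφ
  induction hφ with
  | falsum => exact ⟨0, fun _ _ _ _ _ _ _ => Iff.rfl⟩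
  | imp _ _ ih1 ih2 =>
    obtain ⟨m, hm⟩ := ih1
    obtain ⟨k, hk⟩ := ih2
    exact ⟨max m k, fun a b c d hc hcd h => imp_congr
      (hm a b c d ((le_max_left _ _).trans hc) hcd h)
      (hk a b c d ((le_max_right _ _).trans hc) hcd h)⟩
  | @of_isAtomic φ hφ =>
    obtain ⟨N, hN, hmem⟩ := C.exhaustive n φ hφ
    obtain ⟨k, rfl⟩ := Nat.exists_eq_add_of_le hN
    refine ⟨k, fun a b c d hc hcd h => ?_⟩
    have h' : C.listDiagram (List.ofFn a ++ c.take k) = C.listDiagram (List.ofFn b ++ d.take k) := by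
      refine listDiagram_eq_of_append (c := c.drop k) (d := d.drop k) (by simp [hcd]) ?_
      simpa using h
    obtain ⟨c', hc'⟩ := List.exists_ofFn (l := c.take k) (n := k) (by simp [hc])
    obtain ⟨d', hd'⟩ := List.exists_ofFn (l := d.take k) (n := k) (by simp [hc, ← hcd])
    rw [hc', hd', ← List.ofFn_fin_append, ← List.ofFn_fin_append, listDiagram_ofFn_eq_iff] at h'
    have := h' _ hmem
    rwa [realize_relabel_castLE_append, realize_relabel_castLE_append] at this

theorem qfIsolated : QFIsolated L fun x y : List A => C.listDiagram x = C.listDiagram y := by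
  intro n a
  obtain ⟨θ, h1, h2, h3⟩ := exists_isQF_iff_of_finite (C.level n).finite_toSet
    (fun φ hφ => (C.isAtomic n φ hφ).isQF) a
  exact ⟨θ, h1, h2, fun b hb => listDiagram_ofFn_eq_iff.2 (h3 b hb)⟩

theorem listDiagram_map_equiv (f : A ≃[L] A) (x : List A) :
    C.listDiagram (x.map f) = C.listDiagram x := by
  obtain ⟨n, hn⟩ : ∃ n, x.length = n := ⟨_, rfl⟩
  obtain ⟨a, rfl⟩ := List.exists_ofFn hn
  rw [List.map_ofFn, listDiagram_ofFn_eq_iff]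
  exact fun φ _ => StrongHomClass.realize_formula f φ

variable (C) in
/-- Corresponding subsequences of length at most `K` of two sequences have the same diagram, and
the sequences have the same pattern of repetitions. -/
def AgreeUpTo (K : ℕ) (x y : List A) : Prop :=
  (∀ z ∈ x.zip y, ∀ w ∈ x.zip y, (z.1 = w.1 ↔ z.2 = w.2)) ∧
    ∀ s : List (A × A), s.length ≤ K → (∀ z ∈ s, z ∈ x.zip y) →
      C.listDiagram (s.map Prod.fst) = C.listDiagram (s.map Prod.snd)

/-- Nodes may list entries of a tuple in any order and with repetitions, so their labels are not
read off its own diagram. Those of bounded length still involve only finitely many quantifier-free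
formulas, and one padding controls them all. -/
theorem exists_agreeUpTo (n K : ℕ) : ∃ m : ℕ, ∀ x y c d : List A, x.length = n → y.length = n →
    m ≤ c.length → c.length = d.length → C.listDiagram (x ++ c) = C.listDiagram (y ++ d) →
      C.AgreeUpTo K x y := by
  let Φ : Set (L.Formula (Fin n)) :=
    (Set.range fun p : Fin n × Fin n => Term.equal (Term.var p.1) (Term.var p.2)) ∪
      ⋃ l : Fin (K + 1), ⋃ p : Fin l → Fin n, (Formula.relabel p) '' (C.level l)
  have hΦ : Φ.Finite := (Set.finite_range _).union
    (Set.finite_iUnion fun l => Set.finite_iUnion fun p => (C.level l).finite_toSet.image _)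
  have hq : ∀ φ ∈ Φ, BoundedFormula.IsQF φ := by
    rintro φ (⟨p, rfl⟩ | hφ)
    · exact (BoundedFormula.IsAtomic.equal _ _).isQF
    · simp only [Set.mem_iUnion] at hφ
      obtain ⟨l, p, φ, hφ, rfl⟩ := hφ
      exact (C.isAtomic _ φ hφ).isQF.relabel _
  obtain ⟨m, hm⟩ := (qfDetermined (C := C) (A := A)).of_finite hΦ hq
  refine ⟨m, fun x y c d hx hy hc hcd h => ?_⟩
  obtain ⟨a, rfl⟩ := List.exists_ofFn hx
  obtain ⟨b, rfl⟩ := List.exists_ofFn hy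
  have key := hm a b c d hc hcd h
  constructor
  · intro z hz w hw
    obtain ⟨i, rfl⟩ := List.exists_of_mem_zip_ofFn hz
    obtain ⟨j, rfl⟩ := List.exists_of_mem_zip_ofFn hw
    simpa [Formula.realize_equal] using key _ (Or.inl ⟨(i, j), rfl⟩)
  · intro s hs hz
    obtain ⟨l, hl⟩ : ∃ l, s.length = l := ⟨_, rfl⟩
    obtain ⟨s, rfl⟩ := List.exists_ofFn hl
    have : ∀ j, ∃ i, s j = (a i, b i) := fun j => List.exists_of_mem_zip_ofFn (hz _ (by simp))
    choose p hp using this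
    rw [List.map_ofFn, List.map_ofFn, listDiagram_ofFn_eq_iff]
    intro φ hφ
    have := key (φ.relabel p) (Or.inr (Set.mem_iUnion.2 ⟨⟨l, by omega⟩,
      Set.mem_iUnion.2 ⟨p, φ, hφ, rfl⟩⟩))
    rw [Formula.realize_relabel, Formula.realize_relabel] at this
    have h1 : Prod.fst ∘ s = a ∘ p := funext fun j => congrArg Prod.fst (hp j)
    have h2 : Prod.snd ∘ s = b ∘ p := funext fun j => congrArg Prod.snd (hp j)
    rwa [h1, h2]

end AtomicDiagramCoding

end Diagrams

/-! ## The tree of tuples -/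

section Tree

variable {L : FirstOrder.Language.{u, v}} {A : Type w}

theorem List.mem_zip_swap {M N : Type*} {x : List M} {y : List N} {p : M × N} :
    p.swap ∈ y.zip x ↔ p ∈ x.zip y := by
  rw [← List.zip_swap, List.mem_map]
  exact ⟨fun ⟨q, hq, h⟩ => Prod.swap_injective h ▸ hq, fun h => ⟨p, h, rfl⟩⟩

theorem List.mem_zip_append_singleton {M N : Type*} {x : List M} {y : List N}
    (h : x.length = y.length) {a : M} {b : N} {p : M × N} :
    p ∈ (x ++ [a]).zip (y ++ [b]) ↔ p ∈ x.zip y ∨ p = (a, b) := by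
  rw [List.zip_append h]
  simp

theorem List.mem_zip_ofFn_append {M N : Type*} {n : ℕ} (a : Fin n → M) (b : Fin n → N)
    (c : List M) (d : List N) (i : Fin n) :
    (a i, b i) ∈ (List.ofFn a ++ c).zip (List.ofFn b ++ d) := by
  rw [List.zip_append (by simp)]
  exact List.mem_append_left _ (List.mem_iff_getElem.2 ⟨i, by simp, by simp⟩)

theorem List.exists_mem_zip {M N : Type*} {x : List M} {y : List N} (h : x.length = y.length)
    {a : M} (ha : a ∈ x) : ∃ b, (a, b) ∈ x.zip y := by
  obtain ⟨i, hi, rfl⟩ := List.mem_iff_getElem.1 ha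
  exact ⟨y[i], List.mem_iff_getElem.2 ⟨i, by simp [hi, ← h], List.getElem_zip⟩⟩

/-- Corresponding initial segments have the same position in both sequences of nodes. -/
def SameShape (S : Set (List (A × ℕ) × List (A × ℕ))) : Prop :=
  ∀ p ∈ S, ∀ q ∈ S, ∀ n ≤ p.1.length, (p.1.take n <+: q.1 ↔ p.2.take n <+: q.2)

/-- Two sequences of nodes of the tree of tuples have the same quantifier-free type. -/
def TreeRel [L.Structure A] (C : AtomicDiagramCoding L) (x y : List (List (A × ℕ))) : Prop :=
  x.length = y.length ∧
    (∀ p ∈ x.zip y, C.listDiagram (p.1.map Prod.fst) = C.listDiagram (p.2.map Prod.fst)) ∧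
    SameShape {p | p ∈ x.zip y}

theorem SameShape.mono {S S' : Set (List (A × ℕ) × List (A × ℕ))} (h : S ⊆ S')
    (hS : SameShape S') : SameShape S :=
  fun p hp q hq => hS p (h hp) q (h hq)

theorem TreeOfTuples.map_fst_toList {C : AtomicDiagramCoding L} (σ : TreeOfTuples C A) :
    σ.toList.map Prod.fst = List.ofFn σ.tuple := by
  conv_lhs => rw [← List.ofFn_get σ.toList, List.map_ofFn]
  rfl

/-- A node of the tree of tuples that is a copy of a given tuple. -/
def TreeOfTuples.ofTuple (C : AtomicDiagramCoding L) {n : ℕ} (a : Fin n → A) :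
    TreeOfTuples C A :=
  List.ofFn fun i => (a i, 0)

theorem TreeOfTuples.map_fst_ofTuple {C : AtomicDiagramCoding L} {n : ℕ} (a : Fin n → A) :
    (ofTuple C a).toList.map Prod.fst = List.ofFn a := by
  change (List.ofFn fun i => (a i, 0)).map Prod.fst = _
  rw [List.map_ofFn]
  rfl

variable [L.Structure A] {C : AtomicDiagramCoding L}

theorem TreeOfTuples.label_eq (σ : TreeOfTuples C A) :
    σ.label = C.code (C.listDiagram (σ.toList.map Prod.fst)) := by
  rw [map_fst_toList, AtomicDiagramCoding.listDiagram_ofFn]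
  rfl

theorem TreeOfTuples.label_eq_iff {σ τ : TreeOfTuples C A} : σ.label = τ.label ↔
    C.listDiagram (σ.toList.map Prod.fst) = C.listDiagram (τ.toList.map Prod.fst) := by
  rw [label_eq, label_eq, C.code_injective.eq_iff]

theorem TreeRel.length_eq {x y : List (List (A × ℕ))} (h : TreeRel C x y)
    {p : List (A × ℕ) × List (A × ℕ)} (hp : p ∈ x.zip y) : p.1.length = p.2.length := by
  simpa using AtomicDiagramCoding.length_eq_of_listDiagram_eq (h.2.1 p hp)

theorem TreeRel.take_prefix_take_iff {x y : List (List (A × ℕ))} (h : TreeRel C x y)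
    {p q : List (A × ℕ) × List (A × ℕ)} (hp : p ∈ x.zip y) (hq : q ∈ x.zip y) (k l : ℕ) :
    p.1.take (p.1.length - k) <+: q.1.take (q.1.length - l) ↔
      p.2.take (p.2.length - k) <+: q.2.take (q.2.length - l) := by
  rw [List.prefix_take_iff, List.prefix_take_iff, h.2.2 p hp q hq _ (Nat.sub_le _ _),
    List.length_take, List.length_take, h.length_eq hp, h.length_eq hq]

/-- Terms are iterated parents, that is, truncations of nodes. Natural subtraction matches the
convention that the root is its own parent. -/
theorem exists_realize_term_eq {n : ℕ} (t : labeledTreeLanguage.Term (Fin n ⊕ Fin 0)) :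
    ∃ (i : Fin n) (k : ℕ), ∀ (a : Fin n → TreeOfTuples C A) (e : Fin 0 → TreeOfTuples C A),
      (t.realize (Sum.elim a e)).toList = (a i).toList.take ((a i).toList.length - k) := by
  induction t with
  | var i =>
    rcases i with i | i
    · exact ⟨i, 0, fun a e => by simp⟩
    · exact i.elim0
  | func f ts ih =>
    cases f with
    | parent =>
      obtain ⟨i, k, h⟩ := ih 0
      refine ⟨i, k + 1, fun a e => ?_⟩
      have : ((Term.func (LabeledTreeFunctions.parent : labeledTreeLanguage.Functions 1)
        ts).realize (Sum.elim a e)).toList = ((ts 0).realize (Sum.elim a e)).toList.dropLast := rfl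
      rw [this, h a e, List.dropLast_eq_take, List.take_take, List.length_take]
      congr 1
      omega

variable (C A) in
theorem treeRel_qfDetermined :
    QFDetermined labeledTreeLanguage (M := TreeOfTuples C A) (TreeRel C) := by
  intro n φ hφ
  refine ⟨0, fun a b c d _ _ h => realize_iff_of_isQF (fun φ hφ => ?_) hφ⟩
  have hmem := fun i => List.mem_zip_ofFn_append a b c d i
  have pre := fun i j k l => h.take_prefix_take_iff (hmem i) (hmem j) k l
  cases hφ with
  | equal t s =>
    obtain ⟨i, k, ht⟩ := exists_realize_term_eq (C := C) (A := A) t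
    obtain ⟨j, l, hs⟩ := exists_realize_term_eq (C := C) (A := A) s
    -- Equations are split into two prefix relations, which `SameShape` controls.
    have antisymm : ∀ σ τ : TreeOfTuples C A, σ = τ ↔
        σ.toList <+: τ.toList ∧ τ.toList <+: σ.toList := fun σ τ =>
      ⟨fun h => h ▸ ⟨List.prefix_rfl, List.prefix_rfl⟩, fun h =>
        h.1.eq_of_length (le_antisymm h.1.length_le h.2.length_le)⟩
    rw [Formula.Realize, Formula.Realize, BoundedFormula.realize_bdEqual,
      BoundedFormula.realize_bdEqual, antisymm, antisymm, ht, hs, ht, hs]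
    exact and_congr (pre i j k l) (pre j i l k)
  | rel R ts =>
    rw [Formula.Realize, Formula.Realize, BoundedFormula.realize_rel, BoundedFormula.realize_rel]
    cases R with
    | le =>
      obtain ⟨i, k, ht⟩ := exists_realize_term_eq (C := C) (A := A) (ts 0)
      obtain ⟨j, l, hs⟩ := exists_realize_term_eq (C := C) (A := A) (ts 1)
      change (Term.realize _ _ : TreeOfTuples C A).toList <+:
          (Term.realize _ _ : TreeOfTuples C A).toList ↔
        (Term.realize _ _ : TreeOfTuples C A).toList <+:
          (Term.realize _ _ : TreeOfTuples C A).toList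
      rw [ht, hs, ht, hs]
      exact pre i j k l
    | label m =>
      obtain ⟨i, k, ht⟩ := exists_realize_term_eq (C := C) (A := A) (ts 0)
      change (Term.realize _ _ : TreeOfTuples C A).label = m ↔
        (Term.realize _ _ : TreeOfTuples C A).label = m
      rw [TreeOfTuples.label_eq_iff.2]
      rw [ht, ht, List.map_take, List.map_take]
      have := h.length_eq (hmem i)
      dsimp only at this
      rw [show (a i).toList.length = (b i).toList.length from this]
      exact AtomicDiagramCoding.listDiagram_take (h.2.1 _ (hmem i)) _

/-- The term for the `k`-th iterated parent of a variable. -/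
def parentTerm {n : ℕ} (i : Fin n) : ℕ → labeledTreeLanguage.Term (Fin n)
  | 0 => Term.var i
  | k + 1 => Functions.apply₁ (LabeledTreeFunctions.parent : labeledTreeLanguage.Functions 1)
      (parentTerm i k)

theorem realize_parentTerm {n : ℕ} (i : Fin n) (k : ℕ) (a : Fin n → TreeOfTuples C A) :
    ((parentTerm i k).realize a).toList = (a i).toList.take ((a i).toList.length - k) := by
  induction k with
  | zero => simp [parentTerm]
  | succ k ih =>
    have : ((parentTerm i (k + 1)).realize a).toList =
      ((parentTerm i k).realize a).toList.dropLast := rfl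
    rw [this, ih, List.dropLast_eq_take, List.take_take, List.length_take]
    congr 1
    omega

variable (C A) in
theorem treeRel_qfIsolated :
    QFIsolated labeledTreeLanguage (M := TreeOfTuples C A) (TreeRel C) := by
  intro n a
  obtain ⟨K, hK⟩ : ∃ K, ∀ i, (a i).toList.length ≤ K :=
    ⟨Finset.univ.sup fun i => (a i).toList.length,
      fun i => Finset.le_sup (f := fun i => (a i).toList.length) (Finset.mem_univ i)⟩
  let F : Fin n × Fin n × Fin (K + 1) → labeledTreeLanguage.Formula (Fin n) := fun p =>
    Relations.formula₂ (LabeledTreeRelations.le : labeledTreeLanguage.Relations 2)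
      (parentTerm p.1 p.2.2) (Term.var p.2.1)
  let G : Fin n → labeledTreeLanguage.Formula (Fin n) := fun i =>
    Relations.formula₁ (LabeledTreeRelations.label (a i).label : labeledTreeLanguage.Relations 1)
      (Term.var i)
  have hF : ∀ p (x : Fin n → TreeOfTuples C A), (F p).Realize x ↔
      (x p.1).toList.take ((x p.1).toList.length - p.2.2) <+: (x p.2.1).toList := by
    intro p x
    rw [← realize_parentTerm]
    exact Formula.realize_rel₂
  have hG : ∀ i (x : Fin n → TreeOfTuples C A), (G i).Realize x ↔ (x i).label = (a i).label :=
    fun i x => Formula.realize_rel₁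
  obtain ⟨θ, h1, h2, h3⟩ := exists_isQF_iff_of_finite (Φ := Set.range F ∪ Set.range G)
    ((Set.finite_range F).union (Set.finite_range G))
    (by rintro φ (⟨p, rfl⟩ | ⟨i, rfl⟩) <;> exact (BoundedFormula.IsAtomic.rel _ _).isQF) a
  refine ⟨θ, h1, h2, fun b hb => ?_⟩
  have hlab : ∀ i, C.listDiagram ((a i).toList.map Prod.fst) =
      C.listDiagram ((b i).toList.map Prod.fst) := fun i => by
    have := (h3 b hb (G i) (Or.inr ⟨i, rfl⟩))
    rw [hG, hG] at this
    exact TreeOfTuples.label_eq_iff.1 (this.1 rfl).symm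
  have hlen : ∀ i, (a i).toList.length = (b i).toList.length := fun i => by
    simpa using AtomicDiagramCoding.length_eq_of_listDiagram_eq (hlab i)
  refine ⟨(List.length_ofFn (f := a)).trans (List.length_ofFn (f := b)).symm, fun p hp => ?_,
    fun p hp q hq m hm => ?_⟩
  · obtain ⟨i, rfl⟩ := List.exists_of_mem_zip_ofFn hp
    exact hlab i
  · obtain ⟨i, rfl⟩ := List.exists_of_mem_zip_ofFn hp
    obtain ⟨j, rfl⟩ := List.exists_of_mem_zip_ofFn hq
    replace hm : m ≤ (a i).toList.length := hm
    -- The initial segment of length `m` is the (length − m)-th iterated parent.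
    have := h3 b hb (F (i, j, ⟨(a i).toList.length - m, by have := hK i; omega⟩))
      (Or.inl ⟨_, rfl⟩)
    rw [hF, hF] at this
    dsimp only at this
    rw [← hlen i, Nat.sub_sub_self hm] at this
    exact this

end Tree

/-! ## Automorphisms of the tree of tuples -/

section TreeAutomorphisms

variable {L : FirstOrder.Language.{u, v}} {A : Type w} [L.Structure A]

/-- The shapes agree and corresponding nodes are copies of automorphic tuples. -/
def TreeAutRel (L : FirstOrder.Language.{u, v}) {A : Type w} [L.Structure A]
    (S : Set (List (A × ℕ) × List (A × ℕ))) : Prop :=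
  (∀ p ∈ S, ∃ g : A ≃[L] A, (p.1.map Prod.fst).map g = p.2.map Prod.fst) ∧ SameShape S

theorem TreeAutRel.mono {S S' : Set (List (A × ℕ) × List (A × ℕ))} (h : S ⊆ S')
    (hS : TreeAutRel L S') : TreeAutRel L S :=
  ⟨fun p hp => hS.1 p (h hp), hS.2.mono h⟩

theorem TreeAutRel.length_eq {S : Set (List (A × ℕ) × List (A × ℕ))} (h : TreeAutRel L S)
    {p : List (A × ℕ) × List (A × ℕ)} (hp : p ∈ S) : p.1.length = p.2.length := by
  obtain ⟨g, hg⟩ := h.1 p hp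
  simpa using congrArg List.length hg

theorem List.take_prefix_iff_of_prefix {M : Type*} {x y z : List M} {n : ℕ} (hn : n ≤ x.length)
    (hyz : y <+: z) : x.take n <+: y ↔ n ≤ y.length ∧ x.take n <+: z := by
  refine ⟨fun h => ⟨?_, h.trans hyz⟩, fun ⟨h1, h2⟩ => ?_⟩
  · simpa [hn] using h.length_le
  · exact List.prefix_of_prefix_length_le h2 hyz (by simpa [hn] using h1)

theorem TreeAutRel.symm {S : Set (List (A × ℕ) × List (A × ℕ))} (h : TreeAutRel L S) :
    TreeAutRel L (Prod.swap ⁻¹' S) := by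
  refine ⟨fun p hp => ?_, fun p hp q hq n hn => ?_⟩
  · obtain ⟨g, hg⟩ := h.1 _ hp
    refine ⟨g.symm, ?_⟩
    have hg : (p.2.map Prod.fst).map g = p.1.map Prod.fst := hg
    rw [← hg, List.map_map]
    convert List.map_id _
    funext x
    simp
  · exact (h.2 _ hp _ hq n (hn.trans_eq (h.length_eq hp).symm)).symm

/-- Induction on the node: an ancestor of an old node goes to the corresponding ancestor. Any other
node goes to a child of the image of its parent, with an unused copy number. This is where infinite
replication enters. -/
theorem TreeAutRel.exists_insert {S : Set (List (A × ℕ) × List (A × ℕ))} (hfin : S.Finite)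
    (hS : TreeAutRel L S) (σ : List (A × ℕ)) : ∃ τ, TreeAutRel L (insert (σ, τ) S) := by
  induction σ using List.reverseRecOn generalizing S with
  | nil =>
    refine ⟨[], ?_, ?_⟩
    · rintro p (rfl | hp)
      · exact ⟨FirstOrder.Language.Equiv.refl L A, rfl⟩
      · exact hS.1 p hp
    · rintro p (rfl | hp) q (rfl | hq) n hn
      · simp
      · simp
      · have hl := hS.length_eq hp
        simp only [List.prefix_nil, ← List.length_eq_zero_iff, List.length_take, hl]
      · exact hS.2 p hp q hq n hn
  | append_singleton σ a ih =>
    by_cases hpre : ∃ q ∈ S, σ ++ [a] <+: q.1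
    · obtain ⟨q, hq, hpre⟩ := hpre
      have hle : (σ ++ [a]).length ≤ q.1.length := hpre.length_le
      have heq : σ ++ [a] = q.1.take (σ ++ [a]).length := List.prefix_iff_eq_take.1 hpre
      generalize (σ ++ [a]).length = l at heq hle
      rw [heq]
      have hl := hS.length_eq hq
      have hp2 : q.2.take l <+: q.2 := List.take_prefix _ _
      have hp1 : q.1.take l <+: q.1 := List.take_prefix _ _
      refine ⟨q.2.take l, ?_, ?_⟩
      · rintro p (rfl | hp)
        · obtain ⟨g, hg⟩ := hS.1 q hq
          refine ⟨g, ?_⟩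
          simp only [List.map_take, hg]
        · exact hS.1 p hp
      · rintro p (rfl | hp) r (rfl | hr) n hn
        · exact iff_of_true (List.take_prefix _ _) (List.take_prefix _ _)
        · simp only [List.length_take, le_min_iff] at hn
          simp only [List.take_take, min_eq_left hn.1]
          exact hS.2 q hq r hr n hn.2
        · rw [List.take_prefix_iff_of_prefix hn hp1,
            List.take_prefix_iff_of_prefix (hn.trans_eq (hS.length_eq hp)) hp2,
            hS.2 p hp q hq n hn, List.length_take, List.length_take, hl]
        · exact hS.2 p hp r hr n hn
    · obtain ⟨τ, hτ⟩ := ih hfin hS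
      push Not at hpre
      have hmem : (σ, τ) ∈ insert (σ, τ) S := Set.mem_insert _ _
      have hl : σ.length = τ.length := hτ.length_eq hmem
      obtain ⟨g, hg⟩ := hτ.1 _ hmem
      -- `k` avoids the copy numbers of old nodes at this position; the default 0 for shorter nodes
      -- merely excludes one more value.
      obtain ⟨k, hk⟩ : ∃ k, k ∉ (fun q : List (A × ℕ) × List (A × ℕ) =>
          (q.2[τ.length]?.map Prod.snd).getD 0) '' S :=
        (hfin.image _).exists_notMem
      have hpre' : ∀ q ∈ S, ¬ τ ++ [(g a.1, k)] <+: q.2 := by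
        rintro q hq ⟨t, ht⟩
        refine hk ⟨q, hq, ?_⟩
        simp [← ht]
      refine ⟨τ ++ [(g a.1, k)], ?_, ?_⟩
      · rintro p (rfl | hp)
        · exact ⟨g, by simpa using hg⟩
        · exact hS.1 p hp
      · have split : ∀ n ≤ (σ ++ [a]).length, n ≤ σ.length ∨ n = σ.length + 1 := by
          intro n hn
          rw [List.length_append, List.length_singleton] at hn
          omega
        have full1 : (σ ++ [a]).take (σ.length + 1) = σ ++ [a] := List.take_of_length_le (by simp)
        have full2 : (τ ++ [(g a.1, k)]).take (σ.length + 1) = τ ++ [(g a.1, k)] :=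
          List.take_of_length_le (by simp [hl])
        rintro p (rfl | hp) q (rfl | hq) n hn
        · exact iff_of_true (List.take_prefix _ _) (List.take_prefix _ _)
        · rcases split n hn with hn | rfl
          · dsimp only
            rw [List.take_append_of_le_length hn, List.take_append_of_le_length (hl ▸ hn)]
            exact hτ.2 _ hmem q (Or.inr hq) n hn
          · dsimp only
            rw [full1, full2]
            exact iff_of_false (hpre q hq) (hpre' q hq)
        · have hpl := hS.length_eq hp
          by_cases hnσ : n ≤ σ.length
          · have h1 := List.take_prefix_iff_of_prefix hn (List.prefix_append σ [a])
            have h2 := List.take_prefix_iff_of_prefix (hn.trans_eq hpl)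
              (List.prefix_append τ [(g a.1, k)])
            have h3 := hτ.2 p (Or.inr hp) _ hmem n hn
            dsimp only at h3 ⊢
            rw [h1, h2] at h3
            simpa [hnσ, hl ▸ hnσ] using h3
          -- A prefix this long is the whole new node, which would then lie below an old one.
          · refine iff_of_false (fun h : p.1.take n <+: σ ++ [a] => hpre p hp ?_)
              (fun h : p.2.take n <+: τ ++ [(g a.1, k)] => hpre' p hp ?_)
            · rw [← h.eq_of_length_le (by simp [hn]; omega)]
              exact List.take_prefix _ _
            · rw [← h.eq_of_length_le (by simp [hpl ▸ hn]; omega)]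
              exact List.take_prefix _ _
        · exact hS.2 p hp q hq n hn

instance TreeOfTuples.instCountable (C : AtomicDiagramCoding L) [Countable A] :
    Countable (TreeOfTuples C A) :=
  inferInstanceAs (Countable (List (A × ℕ)))

theorem TreeAutRel.treeRel {C : AtomicDiagramCoding L} {x y : List (List (A × ℕ))}
    (hlen : x.length = y.length) (h : TreeAutRel L {p | p ∈ x.zip y}) : TreeRel C x y := by
  refine ⟨hlen, fun p hp => ?_, h.2⟩
  obtain ⟨g, hg⟩ := h.1 p hp
  rw [← hg, AtomicDiagramCoding.listDiagram_map_equiv]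

theorem TreeAutRel.exists_equiv [Countable A] {C : AtomicDiagramCoding L}
    {x y : List (TreeOfTuples C A)} (hlen : x.length = y.length)
    (h : TreeAutRel L {p : List (A × ℕ) × List (A × ℕ) | p ∈ List.zip x y}) :
    ∃ f : TreeOfTuples C A ≃[labeledTreeLanguage] TreeOfTuples C A, x.map f = y := by
  refine exists_equiv_of_forth (E := fun x y : List (TreeOfTuples C A) => x.length = y.length ∧
    TreeAutRel L {p : List (A × ℕ) × List (A × ℕ) | p ∈ List.zip x y})
    (treeRel_qfDetermined A C) (fun x y h => h.2.treeRel h.1) (fun x y h => h.1)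
    (fun x y h => ⟨h.1.symm, h.2.symm.mono ?_⟩) (fun x y h σ => ?_) ⟨hlen, h⟩
  · exact fun p hp => List.mem_zip_swap.2 hp
  · obtain ⟨τ, hτ⟩ := h.2.exists_insert (List.finite_toSet _) σ
    refine ⟨τ, by rw [List.length_append, List.length_append, h.1]; rfl, hτ.mono fun p hp => ?_⟩
    rcases (List.mem_zip_append_singleton h.1).1 hp with hp | hp
    · exact Or.inr hp
    · exact Or.inl hp

/-- Automorphisms of the tree of tuples relate copies of automorphic tuples. -/
theorem exists_equiv_of_treeEquiv [Countable A] {C : AtomicDiagramCoding L}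
    (f : TreeOfTuples C A ≃[labeledTreeLanguage] TreeOfTuples C A) (σ : TreeOfTuples C A) :
    ∃ g : A ≃[L] A, (σ.toList.map Prod.fst).map g = (f σ).toList.map Prod.fst := by
  have hdiag : ∀ (f : TreeOfTuples C A ≃[labeledTreeLanguage] TreeOfTuples C A)
      (σ : TreeOfTuples C A), C.listDiagram (σ.toList.map Prod.fst) =
        C.listDiagram ((f σ).toList.map Prod.fst) := fun f σ =>
    TreeOfTuples.label_eq_iff.1
      ((f.map_rel (LabeledTreeRelations.label σ.label : labeledTreeLanguage.Relations 1)
        ![σ]).2 rfl).symm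
  refine exists_equiv_of_forth (r := fun x y => C.listDiagram x = C.listDiagram y)
    (E := fun x y => ∃ (f : TreeOfTuples C A ≃[labeledTreeLanguage] TreeOfTuples C A)
      (σ : TreeOfTuples C A), σ.toList.map Prod.fst = x ∧ (f σ).toList.map Prod.fst = y)
    AtomicDiagramCoding.qfDetermined ?_ ?_ ?_ ?_ ⟨f, σ, rfl, rfl⟩
  · rintro _ _ ⟨f, σ, rfl, rfl⟩
    exact hdiag f σ
  · rintro _ _ ⟨f, σ, rfl, rfl⟩
    exact AtomicDiagramCoding.length_eq_of_listDiagram_eq (hdiag f σ)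
  · rintro _ _ ⟨f, σ, rfl, rfl⟩
    exact ⟨f.symm, f σ, rfl, by simp⟩
  · rintro _ _ ⟨f, σ, rfl, rfl⟩ d
    let ν : TreeOfTuples C A := σ.toList ++ [(d, 0)]
    have hν : ν.toList = σ.toList ++ [(d, 0)] := rfl
    have hparent : (f ν).toList.dropLast = (f σ).toList := by
      have h : f ν.parent = (f ν).parent :=
        f.map_fun (LabeledTreeFunctions.parent : labeledTreeLanguage.Functions 1) ![ν]
      have h' : ν.parent = σ := List.dropLast_concat
      rw [h'] at h
      exact congrArg TreeOfTuples.toList h.symm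
    have hne : (f ν).toList ≠ [] := by
      intro h
      have := AtomicDiagramCoding.length_eq_of_listDiagram_eq (hdiag f ν)
      simp [h, hν] at this
    -- The automorphism respects parents, so `f ν` is `f σ` with one entry added; that entry answers
    -- `d`.
    refine ⟨((f ν).toList.getLast hne).1, f, ν, by simp [hν], ?_⟩
    conv_lhs => rw [← List.dropLast_append_getLast hne, hparent]
    simp

end TreeAutomorphisms

/-! ## Comparison of the back-and-forth relations -/

section Comparison

variable {L : FirstOrder.Language.{u, v}} {A : Type w}

/-- The node `τ` arises from `σ` by replacing entries of `x` by corresponding entries of `y`. -/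
def IsCopy (x y : List A) (σ τ : List (A × ℕ)) : Prop :=
  List.Forall₂ (fun a b => a.2 = b.2 ∧ (a.1, b.1) ∈ x.zip y) σ τ

theorem IsCopy.mono {x y x' y' : List A} (hlen : x.length = y.length) {σ τ : List (A × ℕ)}
    (h : IsCopy x y σ τ) : IsCopy (x ++ x') (y ++ y') σ τ :=
  List.Forall₂.imp (fun _ _ hab => ⟨hab.1, by
    rw [List.zip_append hlen]
    exact List.mem_append_left _ hab.2⟩) h

theorem IsCopy.symm {x y : List A} {σ τ : List (A × ℕ)} (h : IsCopy x y σ τ) :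
    IsCopy y x τ σ :=
  (List.Forall₂.imp (fun _ _ hab => ⟨hab.1.symm, List.mem_zip_swap.2 hab.2⟩) h).flip

theorem IsCopy.take {x y : List A} {σ τ : List (A × ℕ)} (h : IsCopy x y σ τ) (n : ℕ) :
    IsCopy x y (σ.take n) (τ.take n) :=
  List.forall₂_take n h

theorem exists_isCopy {x y : List A} (hlen : x.length = y.length) {σ : List (A × ℕ)}
    (h : ∀ a ∈ σ, a.1 ∈ x) : ∃ τ, IsCopy x y σ τ := by
  induction σ with
  | nil => exact ⟨[], .nil⟩
  | cons a σ ih =>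
    obtain ⟨τ, hτ⟩ := ih fun b hb => h b (List.mem_cons_of_mem _ hb)
    obtain ⟨b, hb⟩ := List.exists_mem_zip hlen (h a List.mem_cons_self)
    exact ⟨(b, a.2) :: τ, .cons ⟨rfl, hb⟩ hτ⟩

theorem exists_forall_isCopy {x y : List A} (hlen : x.length = y.length)
    {s : List (List (A × ℕ))} (h : ∀ σ ∈ s, ∀ a ∈ σ, a.1 ∈ x) :
    ∃ t : List (List (A × ℕ)), s.length = t.length ∧ ∀ p ∈ s.zip t, IsCopy x y p.1 p.2 := by
  induction s with
  | nil => exact ⟨[], rfl, by simp⟩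
  | cons σ s ih =>
    obtain ⟨t, ht, hc⟩ := ih fun b hb => h b (List.mem_cons_of_mem _ hb)
    obtain ⟨τ, hτ⟩ := exists_isCopy hlen (h σ List.mem_cons_self)
    refine ⟨τ :: t, by simp [ht], ?_⟩
    rw [List.zip_cons_cons]
    rintro p (_ | ⟨_, hp⟩)
    · exact hτ
    · exact hc p hp

/-- Equal repetition patterns make the substitution well defined and injective, and copy numbers are
unchanged. -/
theorem IsCopy.prefix_iff {x y : List A}
    (hxy : ∀ z ∈ x.zip y, ∀ w ∈ x.zip y, (z.1 = w.1 ↔ z.2 = w.2)) {σ τ σ' τ' : List (A × ℕ)}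
    (h : IsCopy x y σ τ) (h' : IsCopy x y σ' τ') : σ <+: σ' ↔ τ <+: τ' := by
  unfold IsCopy at h h'
  induction h generalizing σ' τ' with
  | nil => simp
  | @cons a b σ τ hab _ ih =>
    cases h' with
    | nil => simp
    | @cons a' b' _ _ hab' h' =>
      rw [List.cons_prefix_cons, List.cons_prefix_cons, ih h', Prod.ext_iff, Prod.ext_iff,
        hxy _ hab.2 _ hab'.2, hab.1, hab'.1]

variable [L.Structure A] {C : AtomicDiagramCoding L}

theorem IsCopy.listDiagram_eq {K : ℕ} {x y : List A} (hxy : C.AgreeUpTo K x y)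
    {σ τ : List (A × ℕ)} (h : IsCopy x y σ τ) (hK : σ.length ≤ K) :
    C.listDiagram (σ.map Prod.fst) = C.listDiagram (τ.map Prod.fst) := by
  obtain ⟨s, h1, h2, h3, h4⟩ : ∃ s : List (A × A), s.length = σ.length ∧
      (∀ z ∈ s, z ∈ x.zip y) ∧ s.map Prod.fst = σ.map Prod.fst ∧
        s.map Prod.snd = τ.map Prod.fst := by
    unfold IsCopy at h
    clear hK
    induction h with
    | nil => exact ⟨[], by simp⟩
    | @cons a b σ τ hab _ ih =>
      obtain ⟨s, h1, h2, h3, h4⟩ := ih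
      exact ⟨(a.1, b.1) :: s, by simp [h1], by simpa [hab.2] using h2, by simp [h3], by simp [h4]⟩
  rw [← h3, ← h4]
  exact hxy.2 s (h1.trans_le hK) h2

theorem treeRel_of_isCopy {K : ℕ} {x y : List A} (hxy : C.AgreeUpTo K x y)
    {s t : List (List (A × ℕ))} (hlen : s.length = t.length)
    (h : ∀ p ∈ s.zip t, IsCopy x y p.1 p.2) (hK : ∀ σ ∈ s, σ.length ≤ K) : TreeRel C s t :=
  ⟨hlen, fun p hp => (h p hp).listDiagram_eq hxy (hK _ (List.of_mem_zip hp).1),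
    fun p hp q hq n _ => ((h p hp).take n).prefix_iff hxy.1 (h q hq)⟩

theorem List.exists_length_le {M : Type*} (s : List (List M)) : ∃ K, ∀ σ ∈ s, σ.length ≤ K := by
  induction s with
  | nil => exact ⟨0, by simp⟩
  | cons σ s ih =>
    obtain ⟨K, hK⟩ := ih
    refine ⟨max σ.length K, ?_⟩
    rintro τ (_ | ⟨_, hτ⟩)
    · exact le_max_left _ _
    · exact (hK τ hτ).trans (le_max_right _ _)

/-- A move `d` on tuples is simulated by a single node extending `p.2` by `d`; equality of shapes
forces the answer to extend `p.1`. -/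
theorem BackForth.listDiagram_of_treeRel {β : Ordinal.{0}} {s t : List (List (A × ℕ))}
    (h : BackForth (TreeRel C) β s t) {p : List (A × ℕ) × List (A × ℕ)} (hp : p ∈ s.zip t) :
    BackForth (fun x y => C.listDiagram x = C.listDiagram y) β
      (p.1.map Prod.fst) (p.2.map Prod.fst) := by
  induction β using WellFoundedLT.induction generalizing s t p with
  | _ β ih =>
  refine backForth_iff.2 ⟨h.base.2.1 p hp, fun γ hγ d => ?_⟩
  have hl := h.base.length_eq hp
  obtain ⟨c, hc, h'⟩ := (backForth_iff.1 h).2 γ hγ [p.2 ++ d.map fun a => (a, 0)]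
  obtain ⟨τ, rfl⟩ := List.length_eq_one_iff.1 hc
  have hmem1 : (p.2, p.1) ∈ (t ++ [p.2 ++ d.map fun a => (a, 0)]).zip (s ++ [τ]) :=
    (List.mem_zip_append_singleton h.base.1.symm).2 (Or.inl (List.mem_zip_swap.2 hp))
  have hmem2 : (p.2 ++ d.map fun a => (a, 0), τ) ∈
      (t ++ [p.2 ++ d.map fun a => (a, 0)]).zip (s ++ [τ]) :=
    (List.mem_zip_append_singleton h.base.1.symm).2 (Or.inr rfl)
  have hpre := (h'.base.2.2 _ hmem1 _ hmem2 _ le_rfl).1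
    (by rw [List.take_length]; exact List.prefix_append _ _)
  dsimp only at hpre
  rw [← hl, List.take_length] at hpre
  obtain ⟨c, rfl⟩ := hpre
  have := h'.base.length_eq hmem2
  refine ⟨c.map Prod.fst, by simpa [hl, eq_comm] using this, ?_⟩
  simpa [Function.comp_def] using ih γ hγ h' hmem2

/-- The pattern of repetitions and the diagrams up to a given length are determined after padding. -/
theorem exists_replicate_agreeUpTo [Nonempty A] (n K : ℕ) :
    ∃ c : List A, ∀ x y d : List A, x.length = n → y.length = n → d.length = c.length →
      (C.listDiagram (x ++ c) = C.listDiagram (y ++ d) → C.AgreeUpTo K x y) := by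
  obtain ⟨m, hm⟩ := AtomicDiagramCoding.exists_agreeUpTo (C := C) (A := A) n K
  exact ⟨List.replicate m (Classical.arbitrary A), fun x y d hx hy hd h =>
    hm x y _ d hx hy (by simp) hd.symm h⟩

/-- All entries of the new nodes are played at once in `A`. `TreeRel` is a separate hypothesis
because the diagrams of `x` and `y` alone may be too short to give it; each move carries the padding
that secures it for the next stage. -/
theorem BackForth.treeRel_of_listDiagram [Nonempty A] {β : Ordinal.{0}} {x y : List A}
    (h : BackForth (fun x y => C.listDiagram x = C.listDiagram y) β x y)
    {s t : List (List (A × ℕ))} (hst : TreeRel C s t)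
    (hcopy : ∀ p ∈ s.zip t, IsCopy x y p.1 p.2) : BackForth (TreeRel C) β s t := by
  induction β using WellFoundedLT.induction generalizing x y s t with
  | _ β ih =>
  refine backForth_iff.2 ⟨hst, fun γ hγ d => ?_⟩
  have hxy := AtomicDiagramCoding.length_eq_of_listDiagram_eq h.base
  let e : List A := d.flatten.map Prod.fst
  -- `K` bounds the nodes whose labels must agree after the move; `c₀` is padding that ensures this.
  obtain ⟨K, hK⟩ := List.exists_length_le (t ++ d)
  obtain ⟨c₀, hc₀⟩ := exists_replicate_agreeUpTo (C := C) (A := A) (y ++ e).length K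
  obtain ⟨c, hc, h'⟩ := (backForth_iff.1 h).2 γ hγ (e ++ c₀)
  rw [List.length_append] at hc
  have hlen : (y ++ e).length = (x ++ c.take e.length).length := by simp [hxy, hc]
  have h'' := h'
  rw [← List.take_append_drop e.length c, ← List.append_assoc, ← List.append_assoc] at h''
  have hagree := hc₀ _ _ _ rfl hlen.symm (by simp [hc]) h''.base
  obtain ⟨d', hd', hcopy'⟩ := exists_forall_isCopy (s := d) hlen (by
    intro σ hσ a ha
    refine List.mem_append_right _ (List.mem_map_of_mem (List.mem_flatten_of_mem hσ ha)))
  have hcopies : ∀ p ∈ (t ++ d).zip (s ++ d'), IsCopy (y ++ e) (x ++ c.take e.length) p.1 p.2 := by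
    rw [List.zip_append hst.1.symm]
    intro p hp
    rcases List.mem_append.1 hp with hp | hp
    · exact (hcopy p.swap (List.mem_zip_swap.2 hp)).symm.mono hxy.symm
    · exact hcopy' p hp
  exact ⟨d', hd'.symm, ih γ hγ h'' (treeRel_of_isCopy hagree (by simp [hst.1, hd']) hcopies hK)
    fun p hp => (hcopies p hp).mono hlen⟩

end Comparison

/-! ## Scott ranks of a structure and of its tree of tuples -/

section ScottRank

variable {L : FirstOrder.Language.{u, v}} {A : Type w} [L.Structure A]
  {C : AtomicDiagramCoding L}

theorem TreeAutRel.mem_autOrbit [Countable A] {n : ℕ} {σ τ : Fin n → TreeOfTuples C A}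
    (h : TreeAutRel L (Set.range fun i => ((σ i).toList, (τ i).toList))) :
    τ ∈ autOrbit labeledTreeLanguage σ := by
  obtain ⟨f, hf⟩ := TreeAutRel.exists_equiv (C := C) (x := List.ofFn σ) (y := List.ofFn τ)
    (by simp) (h.mono fun p hp => by
      obtain ⟨i, rfl⟩ := List.exists_of_mem_zip_ofFn hp
      exact ⟨i, rfl⟩)
  rw [List.map_ofFn] at hf
  exact ⟨f, congrFun (List.ofFn_injective hf)⟩

/-- Each node is isolated through its own tuple, and `TreeRel` fixes the shape. Finitely many levels
below α ≠ 0 have their supremum below α. -/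
theorem OrbitsSigmaDefinable.treeOfTuples [Countable A] {α : Ordinal.{0}} (hα : α ≠ 0)
    (h : OrbitsSigmaDefinable L A α) :
    OrbitsSigmaDefinable labeledTreeLanguage (TreeOfTuples C A) α := by
  rcases isEmpty_or_nonempty A with hA | hA
  · have : Subsingleton (TreeOfTuples C A) := inferInstanceAs (Subsingleton (List (A × ℕ)))
    exact orbitsSigmaDefinable_of_subsingleton α
  intro n σ
  choose β hβ c hc using fun i => exists_orbitIsolated
    (AtomicDiagramCoding.qfDetermined (C := C)) hα h (σ i).tuple
  refine OrbitIsolated.exists_isSigma (M := TreeOfTuples C A) (r := TreeRel C) (β := Finset.univ.sup β)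
    (treeRel_qfIsolated A C)
    ((Finset.sup_lt_iff (bot_lt_iff_ne_bot.2 hα)).2 fun i _ => hβ i) ?_
  -- Above each node, a node that also lists the parameters isolating its tuple.
  let ρ : Fin n → TreeOfTuples C A := fun i => (σ i).toList ++ (c i).map fun a => (a, 0)
  have hρ : ∀ i, (ρ i).toList = (σ i).toList ++ (c i).map fun a => (a, 0) := fun _ => rfl
  refine ⟨List.ofFn ρ, fun τ d hd H => TreeAutRel.mem_autOrbit ⟨?_, ?_⟩⟩
  · rintro _ ⟨i, rfl⟩
    rw [List.length_ofFn] at hd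
    obtain ⟨ν, rfl⟩ := List.exists_ofFn hd
    have hmem1 := List.mem_zip_ofFn_append σ τ (List.ofFn ρ) (List.ofFn ν) i
    have hmem2 : (ρ i, ν i) ∈
        (List.ofFn σ ++ List.ofFn ρ).zip (List.ofFn τ ++ List.ofFn ν) := by
      rw [List.zip_append (by simp)]
      simpa using List.mem_append_right _ (List.mem_zip_ofFn_append ρ ν [] [] i)
    have hl : (σ i).toList.length = (τ i).toList.length := H.base.length_eq hmem1
    have hpre : (σ i).toList.take (σ i).toList.length <+: (ρ i).toList ↔
        (τ i).toList.take (σ i).toList.length <+: (ν i).toList :=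
      H.base.2.2 _ hmem1 _ hmem2 _ le_rfl
    rw [hl, List.take_length, ← hl, List.take_length] at hpre
    obtain ⟨t, ht⟩ := hpre.1 (List.prefix_append _ _)
    have hbf : BackForth _ _ ((ρ i).toList.map Prod.fst) ((ν i).toList.map Prod.fst) :=
      (H.listDiagram_of_treeRel hmem2).mono (Finset.le_sup (Finset.mem_univ i))
    obtain ⟨b, hb⟩ := List.exists_ofFn (l := (τ i).toList.map Prod.fst)
      (n := (σ i).toList.length) (by simp [hl])
    have hlen : (ρ i).toList.length = (ν i).toList.length := H.base.length_eq hmem2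
    rw [← ht, hρ, List.length_append, List.length_append, hl, add_right_inj,
      List.length_map] at hlen
    rw [← ht, hρ, List.map_append, List.map_append, hb, TreeOfTuples.map_fst_toList,
      List.map_map] at hbf
    obtain ⟨g, hg⟩ := hc i b (t.map Prod.fst) (by simp [hlen]) (by
      simpa [Function.comp_def] using hbf)
    refine ⟨g, ?_⟩
    rw [TreeOfTuples.map_fst_toList, List.map_ofFn, hb]
    exact congrArg List.ofFn (funext hg)
  · refine H.base.2.2.mono ?_
    rintro _ ⟨i, rfl⟩
    exact List.mem_zip_ofFn_append σ τ _ _ i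

theorem mem_autOrbit_of_treeOfTuples [Countable A] {n : ℕ} {a b : Fin n → A}
    (h : (fun _ : Fin 1 => TreeOfTuples.ofTuple C b) ∈
      autOrbit labeledTreeLanguage fun _ : Fin 1 => TreeOfTuples.ofTuple C a) :
    b ∈ autOrbit L a := by
  obtain ⟨f, hf⟩ := h
  obtain ⟨g, hg⟩ := exists_equiv_of_treeEquiv f (TreeOfTuples.ofTuple C a)
  rw [hf 0, TreeOfTuples.map_fst_ofTuple, TreeOfTuples.map_fst_ofTuple, List.map_ofFn] at hg
  exact ⟨g, congrFun (List.ofFn_injective hg)⟩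

theorem OrbitsSigmaDefinable.exists_isQF (h : OrbitsSigmaDefinable L A 0) {n : ℕ}
    (a : Fin n → A) : ∃ φ : L.Formula (Fin n), φ.IsQF ∧
      ∀ b : Fin n → A, φ.Realize b ↔ b ∈ autOrbit L a := by
  obtain ⟨φ, hφ, hr⟩ := h n a
  cases hφ with
  | qf _ ψ hq => exact ⟨ψ, hq, hr⟩
  | disjEx k φ β hβ _ => exact absurd (hβ 0) not_lt_zero

/-- Orbits are quantifier-free definable if related tuples are automorphic. -/
theorem QFIsolated.orbitsSigmaDefinable_zero {M : Type*} [L.Structure M]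
    {r : List M → List M → Prop} (hr : QFIsolated L r)
    (h : ∀ (n : ℕ) (a b : Fin n → M), r (List.ofFn a) (List.ofFn b) → b ∈ autOrbit L a) :
    OrbitsSigmaDefinable L M 0 := by
  intro n a
  obtain ⟨θ, hθ, hθa, hθr⟩ := hr n a
  exact ⟨.qf θ hθ, .qf _ _ _, fun b => ⟨fun hb => h n a b (hθr b hb), fun hb =>
    InfFormula.realize_of_mem_autOrbit (φ := .qf θ hθ) hb hθa⟩⟩

/-- The orbit of a tuple is recovered from that of one copy of it. At level 0, the quantifier-free
type of a single node is its label; otherwise the parameters in `A` are the entries of the isolating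
nodes, with padding. -/
theorem OrbitsSigmaDefinable.of_treeOfTuples [Countable A] {α : Ordinal.{0}}
    (h : OrbitsSigmaDefinable labeledTreeLanguage (TreeOfTuples C A) α) :
    OrbitsSigmaDefinable L A α := by
  rcases isEmpty_or_nonempty A with hA | hA
  · exact orbitsSigmaDefinable_of_subsingleton α
  rcases eq_or_ne α 0 with rfl | hα
  · refine (AtomicDiagramCoding.qfIsolated (C := C)).orbitsSigmaDefinable_zero
      fun n a b hab => mem_autOrbit_of_treeOfTuples (C := C) ?_
    obtain ⟨φ, hφ, hr⟩ := h.exists_isQF fun _ : Fin 1 => TreeOfTuples.ofTuple C a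
    obtain ⟨m, hm⟩ := treeRel_qfDetermined A C 1 φ hφ
    rw [← hr]
    refine (hm _ _ (List.replicate m (TreeOfTuples.ofTuple C a))
      (List.replicate m (TreeOfTuples.ofTuple C b)) (by simp) (by simp) ?_).1
      ((hr _).2 ⟨FirstOrder.Language.Equiv.refl _ _, fun _ => rfl⟩)
    have key : ∀ p ∈ List.zip
        (List.ofFn (fun _ : Fin 1 => TreeOfTuples.ofTuple C a) ++
          List.replicate m (TreeOfTuples.ofTuple C a))
        (List.ofFn (fun _ : Fin 1 => TreeOfTuples.ofTuple C b) ++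
          List.replicate m (TreeOfTuples.ofTuple C b)),
        p = (TreeOfTuples.ofTuple C a, TreeOfTuples.ofTuple C b) := by
      intro p hp
      have h1 := (List.of_mem_zip hp).1
      have h2 := (List.of_mem_zip hp).2
      exact Prod.ext (by simp at h1; tauto) (by simp at h2; tauto)
    refine ⟨congrArg Nat.succ ((List.length_replicate (n := m)).trans
      (List.length_replicate (n := m)).symm), fun p hp => ?_, fun p hp q hq k _ => ?_⟩
    · obtain rfl := key p hp
      have h1 := TreeOfTuples.map_fst_ofTuple (C := C) a
      have h2 := TreeOfTuples.map_fst_ofTuple (C := C) b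
      rw [← h1, ← h2] at hab
      exact hab
    · obtain rfl := key p hp
      obtain rfl := key q hq
      exact iff_of_true (List.take_prefix _ _) (List.take_prefix _ _)
  intro n a
  have : Nonempty (TreeOfTuples C A) := ⟨TreeOfTuples.ofTuple C a⟩
  obtain ⟨β, hβ, ρ, hρ⟩ := exists_orbitIsolated (treeRel_qfDetermined A C) hα h
    fun _ : Fin 1 => TreeOfTuples.ofTuple C a
  refine OrbitIsolated.exists_isSigma (AtomicDiagramCoding.qfIsolated (C := C)) hβ ?_
  let s : List (List (A × ℕ)) := ρ
  let e : List A := s.flatten.map Prod.fst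
  obtain ⟨K, hK⟩ := List.exists_length_le ([List.ofFn fun i => (a i, 0)] ++ s)
  obtain ⟨c₀, hc₀⟩ := exists_replicate_agreeUpTo (C := C) (A := A) (List.ofFn a ++ e).length K
  refine ⟨e ++ c₀, fun b d hd H => mem_autOrbit_of_treeOfTuples (C := C) ?_⟩
  rw [List.length_append] at hd
  have hlen : (List.ofFn a ++ e).length = (List.ofFn b ++ d.take e.length).length := by simp [hd]
  rw [← List.take_append_drop e.length d, ← List.append_assoc, ← List.append_assoc] at H
  have hagree := hc₀ _ _ _ rfl hlen.symm (by simp [hd]) H.base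
  obtain ⟨t, ht, hcopy⟩ := exists_forall_isCopy (s := s) hlen (by
    intro σ hσ x hx
    exact List.mem_append_right _ (List.mem_map_of_mem (List.mem_flatten_of_mem hσ hx)))
  have hcopy₀ : IsCopy (List.ofFn a ++ e) (List.ofFn b ++ d.take e.length)
      (List.ofFn fun i => (a i, 0)) (List.ofFn fun i => (b i, 0)) := by
    rw [IsCopy, List.forall₂_iff_get]
    refine ⟨by simp, fun i h1 h2 => ?_⟩
    rw [List.length_ofFn] at h1
    simpa using List.mem_zip_ofFn_append a b e (d.take e.length) ⟨i, h1⟩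
  have hcopies : ∀ p ∈ ([List.ofFn fun i => (a i, 0)] ++ s).zip
      ([List.ofFn fun i => (b i, 0)] ++ t),
      IsCopy (List.ofFn a ++ e) (List.ofFn b ++ d.take e.length) p.1 p.2 := by
    rintro p (_ | ⟨_, hp⟩)
    · exact hcopy₀
    · exact hcopy p hp
  exact hρ _ t ht.symm (H.treeRel_of_listDiagram
    (treeRel_of_isCopy hagree (congrArg Nat.succ ht) hcopies hK) fun p hp => (hcopies p hp).mono hlen)

/-- With full diagrams, a label determines the quantifier-free type of the tuple, hence its orbit.
-/
theorem OrbitsSigmaDefinable.treeOfTuples_of_isFull [Countable A] (hC : C.IsFull)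
    (h : OrbitsSigmaDefinable L A 0) :
    OrbitsSigmaDefinable labeledTreeLanguage (TreeOfTuples C A) 0 := by
  refine (treeRel_qfIsolated A C).orbitsSigmaDefinable_zero
    fun n σ τ hr => TreeAutRel.mem_autOrbit ⟨?_, ?_⟩
  · rintro _ ⟨i, rfl⟩
    have hmem : (σ i, τ i) ∈ (List.ofFn σ).zip (List.ofFn τ) := by
      simpa using List.mem_zip_ofFn_append σ τ [] [] i
    have hdiag := hr.2.1 _ hmem
    have hl : (σ i).toList.length = (τ i).toList.length := hr.length_eq hmem
    obtain ⟨b, hb⟩ := List.exists_ofFn (l := (τ i).toList.map Prod.fst)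
      (n := (σ i).toList.length) (by simp [hl])
    have hdiag : C.listDiagram ((σ i).toList.map Prod.fst) =
      C.listDiagram ((τ i).toList.map Prod.fst) := hdiag
    rw [TreeOfTuples.map_fst_toList, hb, AtomicDiagramCoding.listDiagram_ofFn_eq_iff] at hdiag
    obtain ⟨φ, hφ, hr⟩ := h.exists_isQF (σ i).tuple
    obtain ⟨g, hg⟩ := (hr b).1 ((realize_iff_of_isQF
      (fun ψ hψ => hdiag ψ (hC _ ψ hψ)) hφ).1
        ((hr _).2 ⟨FirstOrder.Language.Equiv.refl _ _, fun _ => rfl⟩))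
    refine ⟨g, ?_⟩
    rw [TreeOfTuples.map_fst_toList, List.map_ofFn, hb]
    exact congrArg List.ofFn (funext hg)
  · refine hr.2.2.mono ?_
    rintro _ ⟨i, rfl⟩
    show (σ i, τ i) ∈ (List.ofFn σ).zip (List.ofFn τ)
    simpa using List.mem_zip_ofFn_append σ τ [] [] i

theorem exists_orbitsSigmaDefinable [Countable A] (C : AtomicDiagramCoding L) :
    ∃ α : Ordinal.{0}, α ≠ 0 ∧ OrbitsSigmaDefinable L A α := by
  obtain ⟨β, hβ⟩ := exists_forall_orbitIsolated
    (AtomicDiagramCoding.qfDetermined (C := C) (A := A))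
    fun _ _ => AtomicDiagramCoding.length_eq_of_listDiagram_eq
  exact ⟨β + 1, (Order.succ_ne_bot β), fun n a =>
    (hβ n a).exists_isSigma AtomicDiagramCoding.qfIsolated (Order.lt_succ β)⟩

theorem exists_isScottRank {M : Type*} [L.Structure M] {α : Ordinal.{0}}
    (h : OrbitsSigmaDefinable L M α) : ∃ β, IsScottRank L M β :=
  ⟨_, csInf_mem (s := {γ : Ordinal.{0} | OrbitsSigmaDefinable L M γ}) ⟨α, h⟩,
    fun _ hγ => csInf_le' hγ⟩

end ScottRank

theorem mainTheorem8 {L : FirstOrder.Language.{u, v}} [Countable L.Symbols]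
    (C : AtomicDiagramCoding L)
    (A : Type w) [L.Structure A] [Countable A] :
    ∃ α β : Ordinal.{0},
      IsScottRank L A α ∧ IsScottRank labeledTreeLanguage (TreeOfTuples C A) β ∧
      ((1 ≤ α ∨ C.IsFull) → β = α) ∧ (α = 0 → β ≤ 1) := by
  obtain ⟨γ, hγ, hA⟩ := exists_orbitsSigmaDefinable (A := A) C
  obtain ⟨α, hα⟩ := exists_isScottRank hA
  obtain ⟨β, hβ⟩ := exists_isScottRank (hA.treeOfTuples (C := C) hγ)
  have hle : α ≤ β := hα.2 (OrbitsSigmaDefinable.of_treeOfTuples hβ.1)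
  refine ⟨α, β, hα, hβ, fun h => le_antisymm ?_ hle, ?_⟩
  · rcases eq_or_ne α 0 with rfl | hα0
    · exact hβ.2 (hα.1.treeOfTuples_of_isFull (h.resolve_left (by simp)))
    · exact hβ.2 (hα.1.treeOfTuples hα0)
  · rintro rfl
    exact hβ.2 (hα.1.one_of_zero.treeOfTuples one_ne_zero)
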